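/- **Setting.** Let $M$ be a connected Hausdorff smooth finite-dimensional manifold with base point $*$ and $G$ a finite-dimensional Lie group. Paths are continuous piecewise smooth maps $[0,1]\to M$ (smooth on the closed intervals of a finite subdivision); $PM$ is the set of paths $p$ with $p(0)=*$, and $\Omega M$ the set of loops at $*$. For paths, $\alpha\circ\beta$ means first $\beta$, then $\alpha$; $p^{-1}$ is the reversed path; $K(p,i)(j):=p(ij)$. A family $\widetilde\psi:U\to PM$ indexed by an open subset $U$ of a manifold (for instance of $\mathbb R^n$) is smooth if $\psi(u,i)=\widetilde\psi[u](i)$ is continuous on $U\times[0,1]$ and there are $0=i_0<\dots<i_{k+1}=1$ with $\psi$ smooth on every $U\times[i_n,i_{n+1}]$. A loop is thin if it is homotopic to the constant loop, relative to $*$, by a homotopy whose image lies in the image of the loop. Let $H:\Omega M\to G$ satisfy: (1) $H(\alpha\circ\beta)=H(\beta)H(\alpha)$; (2) $H(\gamma)=e$ for every thin loop $\gamma$; (3) for all $n$, all open $U\subseteq\mathbb R^n$ and all smooth families of loops $\widetilde\Omega:U\to\Omega M$, the map $H\circ\widetilde\Omega:U\to G$ is smooth. Let $E:=(PM\times G)/T$,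 where $(p,g)\,T\,(p',g')$ iff $p(1)=p'(1)$ and $g'=H(p^{-1}\circ p')g$; write $\{p,g\}$ for the class of $(p,g)$, $\pi\{p,g\}:=p(1)$ and $R_g\{p,h\}:=\{p,hg\}$. For a contractible open $U\subseteq M$ and a smooth family $\widetilde\psi:U\to PM$ with $\widetilde\psi[u](1)=u$ for all $u\in U$, put $C_\psi:U\times G\to\pi^{-1}(U)$, $C_\psi(u,g):=\{\widetilde\psi[u],g\}$. **Proposition 4.1.** $E$ carries the structure of a smooth manifold (modelled on the product of the model spaces of $M$ and $G$) for which every $\pi^{-1}(U)$ is open and every $C_\psi$ is a diffeomorphism of $U\times G$ onto $\pi^{-1}(U)$. For such a structure, $\pi$ and the right action $E\times G\to E$ are smooth. For $a=\{p,g\}\in E$ let $\Gamma_a\subseteq T_aE$ be the span of all velocity vectors, whenever they exist, $$\frac{d}{di}\{K(r,i),h\}\Big|_{i=j},\qquad h:=H\big(p^{-1}\circ K(r,j)\big)g,$$ where $r\in PM$ and $j\in[0,1]$ satisfy $r(j)=p(1)$ (one-sided derivatives if $j\in\{0,1\}$). Then $\Gamma:a\mapsto\Gamma_a$ is a smooth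 connection on $E$, that is: (a) $\Gamma_a\oplus\ker(\pi_*:T_aE\to T_{\pi(a)}M)=T_aE$ for all $a\in E$; (b) $(R_g)_*\Gamma_a=\Gamma_{R_g a}$ for all $a\in E$, $g\in G$; (c) $\Gamma$ is smooth: locally on $E$ it is spanned by a frame of smooth vector fields. -/

import Mathlib

open Set unitInterval
open scoped Manifold ContDiff Topology

noncomputable section

namespace HolonomyReconstruction

/-! Throughout, `M` is a manifold modelled on a real vector space `EM`, and `G` a Lie group modelled
on a real vector space `EG`. Paths are parametrized by `[0,1]`, and `γ.extend : ℝ → M` is the path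
`γ`, prolonged by constants outside of `[0,1]` (only its values on `[0,1]` are ever used). -/

section Paths

variable (EM : Type*) [NormedAddCommGroup EM] [NormedSpace ℝ EM]
  {M : Type*} [TopologicalSpace M] [ChartedSpace EM M]

/-- A (continuous) path is piecewise smooth if there is a finite set `B` of break points such that it
is smooth on each closed subinterval `[a,b]` of `[0,1]` that has no break point in its interior. -/
def IsPiecewiseSmooth {x y : M} (γ : Path x y) : Prop :=
  ∃ B : Finset ℝ, ∀ a b : ℝ, 0 ≤ a → a < b → b ≤ 1 → (∀ c ∈ B, c ∉ Ioo a b) →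
    ContMDiffOn 𝓘(ℝ, ℝ) 𝓘(ℝ, EM) ∞ γ.extend (Icc a b)

variable {EM}

theorem IsPiecewiseSmooth.symm {x y : M} {γ : Path x y} (h : IsPiecewiseSmooth EM γ) :
    IsPiecewiseSmooth EM γ.symm := by
  classical
  obtain ⟨B, hB⟩ := h
  refine ⟨B.image (fun t => 1 - t), fun a b ha hab hb hc => ?_⟩
  have h1 := hB (1 - b) (1 - a) (by linarith) (by linarith) (by linarith) (fun c hcB hcI =>
    hc (1 - c) (Finset.mem_image_of_mem _ hcB) ⟨by linarith [hcI.2], by linarith [hcI.1]⟩)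
  have h2 : ContMDiffOn 𝓘(ℝ, ℝ) 𝓘(ℝ, ℝ) ∞ (fun t : ℝ => 1 - t) (Icc a b) :=
    (contDiff_const.sub contDiff_id).contMDiff.contMDiffOn
  refine (h1.comp h2 ?_).congr ?_
  · intro t ht
    exact ⟨by linarith [ht.2], by linarith [ht.1]⟩
  · intro t _
    exact γ.extend_symm_apply t

theorem IsPiecewiseSmooth.trans {x y z : M} {γ : Path x y} {δ : Path y z}
    (h : IsPiecewiseSmooth EM γ) (h' : IsPiecewiseSmooth EM δ) :
    IsPiecewiseSmooth EM (γ.trans δ) := by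
  classical
  obtain ⟨B, hB⟩ := h
  obtain ⟨B', hB'⟩ := h'
  refine ⟨{1 / 2} ∪ (B.image (fun t => t / 2) ∪ B'.image (fun t => (t + 1) / 2)),
    fun a b ha hab hb hc => ?_⟩
  have hhalf : b ≤ 1 / 2 ∨ 1 / 2 ≤ a := by
    by_contra! hcon
    exact hc (1 / 2) (by simp) ⟨hcon.2, hcon.1⟩
  rcases hhalf with hb2 | ha2
  · have h1 := hB (2 * a) (2 * b) (by linarith) (by linarith) (by linarith) (fun c hcB hcI =>
      hc (c / 2) (Finset.mem_union_right _ (Finset.mem_union_left _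
        (Finset.mem_image_of_mem _ hcB))) ⟨by linarith [hcI.1], by linarith [hcI.2]⟩)
    have h2 : ContMDiffOn 𝓘(ℝ, ℝ) 𝓘(ℝ, ℝ) ∞ (fun t : ℝ => 2 * t) (Icc a b) :=
      (contDiff_const.mul contDiff_id).contMDiff.contMDiffOn
    refine (h1.comp h2 ?_).congr ?_
    · intro t ht
      exact ⟨by linarith [ht.1], by linarith [ht.2]⟩
    · intro t ht
      exact γ.extend_trans_of_le_half δ (ht.2.trans hb2)
  · have h1 := hB' (2 * a - 1) (2 * b - 1) (by linarith) (by linarith) (by linarith)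
      (fun c hcB hcI =>
      hc ((c + 1) / 2) (Finset.mem_union_right _ (Finset.mem_union_right _
        (Finset.mem_image_of_mem (fun t => (t + 1) / 2) hcB)))
        ⟨by linarith [hcI.1], by linarith [hcI.2]⟩)
    have h2 : ContMDiffOn 𝓘(ℝ, ℝ) 𝓘(ℝ, ℝ) ∞ (fun t : ℝ => 2 * t - 1) (Icc a b) :=
      ((contDiff_const.mul contDiff_id).sub contDiff_const).contMDiff.contMDiffOn
    refine (h1.comp h2 ?_).congr ?_
    · intro t ht
      exact ⟨by linarith [ht.1], by linarith [ht.2]⟩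
    · intro t ht
      exact γ.extend_trans_of_half_le δ (ha2.trans ht.1)

/-- The contraction `K(γ,i)(j) = γ(ij)` of a path, as a path from `γ(0)` to `γ(i)`. -/
def contractPath {x y : M} (γ : Path x y) (i : I) : Path x (γ i) where
  toFun j := γ (i * j)
  continuous_toFun := by fun_prop
  source' := by simp
  target' := by simp

theorem contractPath_extend {x y : M} (γ : Path x y) (i : I) {t : ℝ} (ht : t ∈ Icc (0 : ℝ) 1) :
    (contractPath γ i).extend t = γ.extend (i * t) := by
  have h : (i : ℝ) * t ∈ Icc (0 : ℝ) 1 := (i * ⟨t, ht⟩ : I).2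
  rw [Path.extend_apply _ ht, Path.extend_apply _ h]
  rfl

theorem IsPiecewiseSmooth.contractPath {x y : M} {γ : Path x y}
    (h : IsPiecewiseSmooth EM γ) (i : I) : IsPiecewiseSmooth EM (contractPath γ i) := by
  classical
  obtain ⟨B, hB⟩ := h
  rcases eq_or_lt_of_le i.2.1 with h0 | h0
  · refine ⟨∅, fun a b ha _ hb _ => ?_⟩
    refine (contMDiffOn_const (c := γ.extend 0)).congr ?_
    intro t ht
    rw [contractPath_extend γ i ⟨ha.trans ht.1, ht.2.trans hb⟩, ← h0, zero_mul]
  · refine ⟨B.image (fun t => t / i), fun a b ha hab hb hc => ?_⟩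
    have h1 := hB (i * a) (i * b) (by positivity) (by gcongr)
      (by nlinarith [i.2.2]) (fun c hcB hcI =>
      hc (c / i) (Finset.mem_image_of_mem _ hcB)
        ⟨(lt_div_iff₀' h0).2 hcI.1, (div_lt_iff₀' h0).2 hcI.2⟩)
    have h2 : ContMDiffOn 𝓘(ℝ, ℝ) 𝓘(ℝ, ℝ) ∞ (fun t : ℝ => (i : ℝ) * t) (Icc a b) :=
      (contDiff_const.mul contDiff_id).contMDiff.contMDiffOn
    refine (h1.comp h2 ?_).congr ?_
    · intro t ht
      exact ⟨mul_le_mul_of_nonneg_left ht.1 h0.le, mul_le_mul_of_nonneg_left ht.2 h0.le⟩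
    · intro t ht
      exact contractPath_extend γ i ⟨ha.trans ht.1, ht.2.trans hb⟩

variable (EM)

/-- The piecewise smooth paths of `M` from `x` to `y`. -/
structure PwPath (x y : M) where
  toPath : Path x y
  smooth : IsPiecewiseSmooth EM toPath

/-- The space `ΩM` of piecewise smooth loops based at `x₀`. -/
abbrev PwLoopSpace (x₀ : M) := PwPath EM x₀ x₀

/-- The space `PM` of piecewise smooth paths that start at `x₀`, as pairs of the end point `p(1)` and
a path from `x₀` to it. -/
def PwPathSpace (x₀ : M) := Σ y : M, PwPath EM x₀ y

variable {EM} {x₀ : M}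

/-- First `γ`, then `δ`; in the notation for products of paths: `δ ∘ γ`. -/
def PwPath.trans {x y z : M} (γ : PwPath EM x y) (δ : PwPath EM y z) : PwPath EM x z :=
  ⟨γ.toPath.trans δ.toPath, γ.smooth.trans δ.smooth⟩

/-- The reversed path `γ⁻¹`. -/
def PwPath.symm {x y : M} (γ : PwPath EM x y) : PwPath EM y x :=
  ⟨γ.toPath.symm, γ.smooth.symm⟩

/-- A loop is thin if it can be contracted to the constant loop, relative to the base point, inside
its own image. -/
def IsThin (γ : PwLoopSpace EM x₀) : Prop :=
  ∃ F : γ.toPath.Homotopy (Path.refl x₀), range F ⊆ range γ.toPath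

namespace PwPathSpace

/-- The end point `p(1)`. -/
def endpoint (p : PwPathSpace EM x₀) : M := p.1

/-- The point `p(i)`, for `i ∈ [0,1]`. -/
def eval (p : PwPathSpace EM x₀) (i : ℝ) : M := p.2.toPath.extend i

/-- The contraction `K(p,i)`, `K(p,i)(j) = p(ij)`, for `i ∈ [0,1]` (other `i ∈ ℝ` are replaced by the
nearest point of `[0,1]`). -/
def contract (p : PwPathSpace EM x₀) (i : ℝ) : PwPathSpace EM x₀ :=
  ⟨p.eval i, ⟨contractPath p.2.toPath (projIcc 0 1 zero_le_one i), p.2.smooth.contractPath _⟩⟩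

/-- The loop `p⁻¹ ∘ p'`: first along `p'`, then back along `p`, for `p(1) = p'(1)`. -/
def invComp (p p' : PwPathSpace EM x₀) (h : p.endpoint = p'.endpoint) : PwLoopSpace EM x₀ :=
  p'.2.trans ⟨p.2.symm.toPath.cast h.symm rfl, p.2.symm.smooth⟩

/-- A loop as an element of the space of paths. -/
def ofLoop (γ : PwLoopSpace EM x₀) : PwPathSpace EM x₀ := ⟨x₀, γ⟩

/-- A family of paths `ψ`, indexed by an open subset `U` of a manifold `N`, is smooth if its
associated map `(u,i) ↦ ψ[u](i)` is continuous on `U × [0,1]` and there is a finite set `B` of break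
points such that the map is smooth on `U × [a,b]` for each `[a,b] ⊆ [0,1]` that has no break point in
its interior. -/
def IsSmoothFamilyOn (EN : Type*) [NormedAddCommGroup EN] [NormedSpace ℝ EN]
    {N : Type*} [TopologicalSpace N] [ChartedSpace EN N] (U : Set N) (ψ : N → PwPathSpace EM x₀) : Prop :=
  ContinuousOn (fun z : N × ℝ => (ψ z.1).eval z.2) (U ×ˢ Icc (0 : ℝ) 1) ∧
  ∃ B : Finset ℝ, ∀ a b : ℝ, 0 ≤ a → a < b → b ≤ 1 → (∀ c ∈ B, c ∉ Ioo a b) →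
    ContMDiffOn (𝓘(ℝ, EN).prod 𝓘(ℝ, ℝ)) 𝓘(ℝ, EM) ∞
      (fun z : N × ℝ => (ψ z.1).eval z.2) (U ×ˢ Icc a b)

end PwPathSpace

end Paths

section Connection

variable {EP : Type*} [NormedAddCommGroup EP] [NormedSpace ℝ EP]
  {HP : Type*} [TopologicalSpace HP] (IP : ModelWithCorners ℝ EP HP)
  {P : Type*} [TopologicalSpace P] [ChartedSpace HP P] [IsManifold IP ∞ P]
  {EM : Type*} [NormedAddCommGroup EM] [NormedSpace ℝ EM]
  {HM : Type*} [TopologicalSpace HM] (IM : ModelWithCorners ℝ EM HM)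
  {M : Type*} [TopologicalSpace M] [ChartedSpace HM M] {G : Type*}

/-- A smooth connection on a principal bundle with projection `π : P → M` and right action `R`: a
distribution `Γ` on `P` that is complementary to the vertical subspaces `ker π_*`, invariant under
the right action, and smooth, i.e. locally spanned by a frame of smooth vector fields. -/
structure IsSmoothConnection (π : P → M) (R : P → G → P)
    (Γ : (a : P) → Submodule ℝ (TangentSpace IP a)) : Prop where
  isCompl : ∀ a : P, IsCompl (Γ a) (LinearMap.ker (mfderiv IP IM π a).toLinearMap)
  equivariant : ∀ (a : P) (g : G),
    (Γ a).map (mfderiv IP IP (fun b => R b g) a).toLinearMap = Γ (R a g)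
  smooth : ∀ a : P, ∃ V : Set P, IsOpen V ∧ a ∈ V ∧
    ∃ (k : ℕ) (X : Fin k → (b : P) → TangentSpace IP b),
      (∀ μ, ContMDiffOn IP IP.tangent ∞ (fun b => (⟨b, X μ b⟩ : TangentBundle IP P)) V) ∧
      ∀ b ∈ V, LinearIndependent ℝ (fun μ => X μ b) ∧
        Γ b = Submodule.span ℝ (range fun μ => X μ b)

end Connection

section Bundle

variable {EM : Type*} [NormedAddCommGroup EM] [NormedSpace ℝ EM]
  {M : Type*} [TopologicalSpace M] [ChartedSpace EM M] {x₀ : M}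
  {EG : Type*} [NormedAddCommGroup EG] [NormedSpace ℝ EG]
  {G : Type*} [TopologicalSpace G] [ChartedSpace EG G] [Group G]

variable (EG) in
/-- The axioms of a holonomy map `H : ΩM → G`. -/
structure IsHolonomyMap (H : PwLoopSpace EM x₀ → G) : Prop where
  /-- `H(α ∘ β) = H(β) H(α)`, where `α ∘ β` is first `β`, then `α`. -/
  map_comp : ∀ α β : PwLoopSpace EM x₀, H (β.trans α) = H β * H α
  map_thin : ∀ γ : PwLoopSpace EM x₀, IsThin γ → H γ = 1
  smooth : ∀ (n : ℕ) (U : Set (EuclideanSpace ℝ (Fin n))), IsOpen U →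
    ∀ Ω : EuclideanSpace ℝ (Fin n) → PwLoopSpace EM x₀,
      PwPathSpace.IsSmoothFamilyOn (EuclideanSpace ℝ (Fin n)) U
        (fun u => PwPathSpace.ofLoop (Ω u)) →
        ContMDiffOn 𝓘(ℝ, EuclideanSpace ℝ (Fin n)) 𝓘(ℝ, EG) ∞ (fun u => H (Ω u)) U

/-- `(p,g) T (p',g')` iff `p(1) = p'(1)` and `g' = H(p⁻¹ ∘ p') g`. -/
def BundleRel (H : PwLoopSpace EM x₀ → G) (a b : PwPathSpace EM x₀ × G) : Prop :=
  ∃ h : a.1.endpoint = b.1.endpoint, b.2 = H (a.1.invComp b.1 h) * a.2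

/-- The total space `E = (PM × G)/T`. (If `H` is a holonomy map, `T` is an equivalence relation.) -/
def ReconstructedBundle (H : PwLoopSpace EM x₀ → G) := Quot (BundleRel H)

namespace ReconstructedBundle

variable (H : PwLoopSpace EM x₀ → G)

/-- The class `{p,g}` of `(p,g)`. -/
def mk (p : PwPathSpace EM x₀) (g : G) : ReconstructedBundle H := Quot.mk _ (p, g)

variable {H}

/-- The projection `π{p,g} = p(1)`. -/
def proj : ReconstructedBundle H → M :=
  Quot.lift (fun a => a.1.endpoint) (fun _ _ h => h.choose)

/-- The right action `R_g{p,h} = {p,hg}`. -/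
def act (a : ReconstructedBundle H) (g : G) : ReconstructedBundle H :=
  Quot.map (fun b => (b.1, b.2 * g))
    (fun b c ⟨h, hc⟩ => ⟨h, by rw [hc, mul_assoc]⟩) a

variable (H) in
/-- The local trivialization `C_ψ(u,g) = {ψ[u],g}`, for a family of paths `ψ`. -/
def triv (ψ : M → PwPathSpace EM x₀) (z : M × G) : ReconstructedBundle H := mk H (ψ z.1) z.2

variable (EG H) in
/-- The charts of `E` make up the differential structure that is given by the local trivializations:
for each contractible open `U ⊆ M` and each smooth family `ψ` of paths over `U` with `ψ[u](1) = u`,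
the map `C_ψ` is a diffeomorphism from `U × G` onto the open set `π⁻¹(U)`. -/
def HasReconstructedCharts [TopologicalSpace (ReconstructedBundle H)]
    [ChartedSpace (ModelProd EM EG) (ReconstructedBundle H)] : Prop :=
  ∀ (U : Set M), IsOpen U → ContractibleSpace U →
    ∀ ψ : M → PwPathSpace EM x₀, PwPathSpace.IsSmoothFamilyOn EM U ψ → (∀ u ∈ U, (ψ u).endpoint = u) →
      ∃ Φ : PartialDiffeomorph (𝓘(ℝ, EM).prod 𝓘(ℝ, EG)) (𝓘(ℝ, EM).prod 𝓘(ℝ, EG))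
          (M × G) (ReconstructedBundle H) ∞,
        Φ.source = U ×ˢ univ ∧ Φ.target = proj ⁻¹' U ∧ EqOn Φ.toFun (triv H ψ) (U ×ˢ univ)

variable (EG) in
/-- The distribution `Γ`: at `a = {p,g}` it is spanned by the velocities at `i = j` of the curves
`[0,1] ∋ i ↦ {K(r,i), h}` with `h = H(p⁻¹ ∘ K(r,j)) g`, where `r ∈ PM` and `j ∈ [0,1]` satisfy
`r(j) = p(1)`, so that the curve is at `a` for `i = j`. All those velocities are taken that exist
(one-sided ones at the ends of `[0,1]`). -/
def Γ [TopologicalSpace (ReconstructedBundle H)] [ChartedSpace (ModelProd EM EG) (ReconstructedBundle H)]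
    (a : ReconstructedBundle H) : Submodule ℝ (TangentSpace (𝓘(ℝ, EM).prod 𝓘(ℝ, EG)) a) :=
  Submodule.span ℝ
    {v | ∃ (p : PwPathSpace EM x₀) (g : G) (r : PwPathSpace EM x₀) (j : ℝ)
        (hj : p.endpoint = (r.contract j).endpoint),
      a = mk H p g ∧ j ∈ Icc (0 : ℝ) 1 ∧
      HasMFDerivWithinAt 𝓘(ℝ, ℝ) (𝓘(ℝ, EM).prod 𝓘(ℝ, EG))
        (fun i : ℝ => mk H (r.contract i) (H (p.invComp (r.contract j) hj) * g)) (Icc 0 1) j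
        (ContinuousLinearMap.toSpanSingleton ℝ (M₁ := EM × EG) v)}

end ReconstructedBundle

end Bundle

end HolonomyReconstruction

end

open HolonomyReconstruction

/-! The holonomy of a loop does not change under reparametrization or when a detour and its return
are inserted, because the loops that measure the change contract inside their own images. Hence `T`
is an equivalence relation, and prolonging representatives by a fixed curve is well defined on
classes (`mk_glue_congr`). Two trivializations differ by left multiplication with the holonomy of
the loops ψ[u]⁻¹ ∘ ψ'[u], which is smooth in u. All of them together give the atlas, and the class
of any smooth family of paths is smooth (`contMDiffOn_mk`).

The distribution Γ is compared with something linear by construction. Over a convex chart ball,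
transport a point a along the coordinate segment to the point with coordinates w. This is smooth in
(a,w), and its w-derivative at the coordinates of π(a) is `horizontalLift`. Its range is Γ_a
(`Γ_eq_range_horizontalLift`). The three properties then follow by differentiation: π maps the
transported point to the point with coordinates w, transport commutes with the right action, and the
derivative depends smoothly on a.

That the range lies in Γ_a is seen from paths ending with a segment. The converse,
`mem_range_horizontalLift`, is the crux: r may have a corner at j, so it is smooth on one side only,
while `H` is smooth only over open parameter sets. Let c(y) be one side of r in the chart.
Substituting an even function gives c(s²/(1+s²)) = c(0) + s² C(s) with C smooth on ℝ. The curves t ↦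
c(0) + y t² C(st) define a smooth map T(y,s) into E. It is constant for y = 0, is transport along a
segment with direction C(0) for s = 0, and is the given curve for y = s². Since T is constant on the
axis y = 0, the derivative of T(y,√y) at y = 0 is the partial derivative in y, which is the lift of
C(0). -/

namespace HolonomyReconstruction

/-! ### Thin loops and loops with trivial holonomy. -/

section ThinLoops

variable {EM : Type*} [NormedAddCommGroup EM] [NormedSpace ℝ EM]
  {M : Type*} [TopologicalSpace M] [ChartedSpace EM M] {x₀ : M}

/-- A loop that factors through a null-homotopic loop of a space whose points all come from the loop
is thin. -/
theorem isThin_of_homotopic_refl {X : Type*} [TopologicalSpace X] {x : X} {L : Path x x}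
    (hL : L.Homotopic (Path.refl x)) {f : X → M} (hf : Continuous f) (hx : f x = x₀)
    {γ : PwLoopSpace EM x₀} (hγ : ∀ t, γ.toPath t = f (L t)) (hr : range f ⊆ range γ.toPath) :
    IsThin γ := by
  obtain ⟨F⟩ := hL
  subst hx
  refine ⟨(F.map ⟨f, hf⟩).cast (by ext t; exact (hγ t).symm) (by ext t; rfl), ?_⟩
  rintro _ ⟨z, rfl⟩
  exact hr ⟨F z, rfl⟩

/-- A loop that factors through a loop of the real line is thin. -/
theorem isThin_of_real {a : ℝ} (L : Path a a) {f : ℝ → M} (hf : Continuous f)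
    {γ : PwLoopSpace EM x₀} (hγ : ∀ t, γ.toPath t = f (L t)) : IsThin γ := by
  -- The image of `L` is an interval. Contracting `L` there, and not in all of ℝ, keeps the homotopy
  -- inside the image of the loop.
  have hR : (range L).OrdConnected :=
    (isPreconnected_range L.continuous).ordConnected
  have ha : a ∈ range L := ⟨0, L.source⟩
  have : ContractibleSpace (range L) :=
    hR.convex.contractibleSpace ⟨a, ha⟩
  let L' : Path (⟨a, ha⟩ : range L) ⟨a, ha⟩ :=
    { toFun := fun t => ⟨L t, t, rfl⟩
      continuous_toFun := by fun_prop
      source' := by simp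
      target' := by simp }
  refine isThin_of_homotopic_refl (L := L') (SimplyConnectedSpace.paths_homotopic _ _)
    (hf.comp continuous_subtype_val) ?_ hγ ?_
  · have := hγ 0
    simpa using this.symm
  · rintro _ ⟨⟨_, t, rfl⟩, rfl⟩
    exact ⟨t, hγ t⟩

variable {EG : Type*} [NormedAddCommGroup EG] [NormedSpace ℝ EG]
  {G : Type*} [TopologicalSpace G] [ChartedSpace EG G] [Group G] {H : PwLoopSpace EM x₀ → G}

/-- The affine path between two real numbers. -/
def realSegment (a b : ℝ) : Path a b where
  toFun t := a + t * (b - a)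
  continuous_toFun := by fun_prop
  source' := by simp
  target' := by simp

theorem realSegment_apply (a b : ℝ) (t : I) : realSegment a b t = a + t * (b - a) := rfl

/-- If two paths are reparametrizations of the same curve, and end at the same parameter, then the
loop they form has trivial holonomy. -/
theorem IsHolonomyMap.map_trans_symm_of_real (hH : IsHolonomyMap EG H) {y : M}
    {a b : PwPath EM x₀ y} {s t : ℝ} (A B : Path s t) {f : ℝ → M} (hf : Continuous f)
    (ha : ∀ i, a.toPath i = f (A i)) (hb : ∀ i, b.toPath i = f (B i)) :
    H (b.trans a.symm) = 1 := by
  refine hH.map_thin _ (isThin_of_real (B.trans A.symm) hf fun i => ?_)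
  simp only [PwPath.trans, PwPath.symm, Path.trans_apply, Path.symm_apply]
  split_ifs
  · exact hb _
  · exact ha _

theorem IsHolonomyMap.map_trans_symm_self (hH : IsHolonomyMap EG H) {y : M} (a : PwPath EM x₀ y) :
    H (a.trans a.symm) = 1 := by
  have h : ∀ i : I, a.toPath i = a.toPath.extend (realSegment 0 1 i) := fun i => by
    rw [realSegment_apply, sub_zero, mul_one, zero_add, Path.extend_extends']
  exact hH.map_trans_symm_of_real (realSegment 0 1) (realSegment 0 1)
    a.toPath.continuous_extend h h

/-- Two loops that come from homotopic loops of a space all of whose points are met by one of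
the two have the same holonomy. -/
theorem IsHolonomyMap.congr_of_homotopic (hH : IsHolonomyMap EG H)
    {X : Type*} [TopologicalSpace X] {x : X} {P Q : Path x x}
    (hPQ : P.Homotopic Q) {f : X → M} (hf : Continuous f)
    {γ δ : PwLoopSpace EM x₀} (hγ : ∀ t, γ.toPath t = f (P t)) (hδ : ∀ t, δ.toPath t = f (Q t))
    (hr : range f ⊆ range γ.toPath ∪ range δ.toPath) : H γ = H δ := by
  have h1 : H (PwPath.trans γ δ.symm) = 1 := by
    refine hH.map_thin _ (isThin_of_homotopic_refl (L := P.trans Q.symm) ?_ hf ?_ ?_ ?_)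
    · rw [← Path.Homotopic.Quotient.eq] at hPQ ⊢
      simp [hPQ]
    · simpa using (hγ 0).symm
    · intro t
      simp only [PwPath.trans, PwPath.symm, Path.trans_apply, Path.symm_apply]
      split_ifs
      · exact hγ _
      · exact hδ _
    · rw [PwPath.trans, PwPath.symm, Path.trans_range, Path.symm_range]
      exact hr
  have h2 := hH.map_trans_symm_self δ
  rw [hH.map_comp] at h1 h2
  exact mul_right_cancel (h1.trans h2.symm)

/-- A path, as a path of a subspace that contains it. -/
def pathCodRestrict {x y : M} (p : Path x y) (R : Set M) (h : range p ⊆ R) :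
    Path (⟨x, h ⟨0, p.source⟩⟩ : R) ⟨y, h ⟨1, p.target⟩⟩ where
  toFun t := ⟨p t, h ⟨t, rfl⟩⟩
  continuous_toFun := by fun_prop
  source' := by simp
  target' := by simp

/-- The detour back along `b` and out again cancels up to homotopy. The homotopy runs in the union
of the three images, all of which the longer loop covers, as thinness demands. -/
theorem IsHolonomyMap.map_trans_symm_mul (hH : IsHolonomyMap EG H) {y : M}
    (a b c : PwPath EM x₀ y) :
    H (c.trans b.symm) * H (b.trans a.symm) = H (c.trans a.symm) := by
  rw [← hH.map_comp]
  set R : Set M := range a.toPath ∪ (range b.toPath ∪ range c.toPath) with hR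
  let A := pathCodRestrict a.toPath R subset_union_left
  let B := pathCodRestrict b.toPath R (subset_union_left.trans subset_union_right)
  let C := pathCodRestrict c.toPath R (subset_union_right.trans subset_union_right)
  refine hH.congr_of_homotopic (X := R) (f := Subtype.val)
    (P := (C.trans B.symm).trans (B.trans A.symm)) (Q := C.trans A.symm) ?_
    continuous_subtype_val ?_ ?_ ?_
  · rw [← Path.Homotopic.Quotient.eq]
    simp only [Path.Homotopic.Quotient.mk_trans, Path.Homotopic.Quotient.mk_symm]
    rw [Path.Homotopic.Quotient.trans_assoc,
      ← Path.Homotopic.Quotient.trans_assoc (Path.Homotopic.Quotient.symm _)]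
    simp
  · intro t
    simp only [PwPath.trans, PwPath.symm, Path.trans_apply, Path.symm_apply, Function.comp_apply]
    split_ifs <;> rfl
  · intro t
    simp only [PwPath.trans, PwPath.symm, Path.trans_apply, Path.symm_apply, Function.comp_apply]
    split_ifs <;> rfl
  · rw [Subtype.range_coe, hR]
    simp only [PwPath.trans, PwPath.symm, Path.trans_range, Path.symm_range]
    intro z hz
    simp only [mem_union] at hz ⊢
    tauto

/-- The tail `q` and its return cancel inside the image of the longer loop. This makes prolongation
of paths compatible with `T`. -/
theorem IsHolonomyMap.map_trans_trans_symm (hH : IsHolonomyMap EG H) {y z : M}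
    (a b : PwPath EM x₀ y) (q : PwPath EM y z) :
    H ((b.trans q).trans (a.trans q).symm) = H (b.trans a.symm) := by
  set R : Set M := range a.toPath ∪ (range b.toPath ∪ range q.toPath) with hR
  let A := pathCodRestrict a.toPath R subset_union_left
  let B := pathCodRestrict b.toPath R (subset_union_left.trans subset_union_right)
  let Q := pathCodRestrict q.toPath R (subset_union_right.trans subset_union_right)
  refine hH.congr_of_homotopic (X := R) (f := Subtype.val)
    (P := (B.trans Q).trans (A.trans Q).symm) (Q := B.trans A.symm) ?_
    continuous_subtype_val ?_ ?_ ?_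
  · rw [← Path.Homotopic.Quotient.eq, Path.trans_symm]
    simp only [Path.Homotopic.Quotient.mk_trans, Path.Homotopic.Quotient.mk_symm]
    rw [Path.Homotopic.Quotient.trans_assoc,
      ← Path.Homotopic.Quotient.trans_assoc (Path.Homotopic.Quotient.mk Q)]
    simp
  · intro t
    simp only [PwPath.trans, PwPath.symm, Path.trans_apply, Path.symm_apply, Function.comp_apply]
    split_ifs <;> rfl
  · intro t
    simp only [PwPath.trans, PwPath.symm, Path.trans_apply, Path.symm_apply, Function.comp_apply]
    split_ifs <;> rfl
  · rw [Subtype.range_coe, hR]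
    simp only [PwPath.trans, PwPath.symm, Path.trans_range, Path.symm_range]
    intro z hz
    simp only [mem_union] at hz ⊢
    tauto

end ThinLoops

/-! ### Equality of classes in the total space. -/

section Classes

variable {EM : Type*} [NormedAddCommGroup EM] [NormedSpace ℝ EM]
  {M : Type*} [TopologicalSpace M] [ChartedSpace EM M] {x₀ : M}
  {EG : Type*} [NormedAddCommGroup EG] [NormedSpace ℝ EG]
  {G : Type*} [TopologicalSpace G] [ChartedSpace EG G] [Group G] {H : PwLoopSpace EM x₀ → G}

theorem PwPathSpace.invComp_mk {y : M} (a b : PwPath EM x₀ y) :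
    PwPathSpace.invComp (⟨y, a⟩ : PwPathSpace EM x₀) ⟨y, b⟩ rfl = b.trans a.symm := rfl

theorem IsHolonomyMap.invComp_self (hH : IsHolonomyMap EG H) (p : PwPathSpace EM x₀) :
    H (p.invComp p rfl) = 1 := by
  obtain ⟨y, a⟩ := p
  exact hH.map_trans_symm_self a

theorem IsHolonomyMap.invComp_mul (hH : IsHolonomyMap EG H) (p p' p'' : PwPathSpace EM x₀)
    (h : p.endpoint = p'.endpoint) (h' : p'.endpoint = p''.endpoint) :
    H (p'.invComp p'' h') * H (p.invComp p' h) = H (p.invComp p'' (h.trans h')) := by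
  obtain ⟨y, a⟩ := p
  obtain ⟨y', b⟩ := p'
  obtain ⟨y'', c⟩ := p''
  obtain rfl : y = y' := h
  obtain rfl : y = y'' := h'
  exact hH.map_trans_symm_mul a b c

theorem IsHolonomyMap.equivalence (hH : IsHolonomyMap EG H) : Equivalence (BundleRel H) where
  refl a := ⟨rfl, by rw [hH.invComp_self, one_mul]⟩
  symm := by
    rintro a b ⟨h, hg⟩
    refine ⟨h.symm, ?_⟩
    rw [hg, ← mul_assoc, hH.invComp_mul, hH.invComp_self, one_mul]
  trans := by
    rintro a b c ⟨h, hg⟩ ⟨h', hg'⟩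
    refine ⟨h.trans h', ?_⟩
    rw [hg', hg, ← mul_assoc, hH.invComp_mul]

namespace ReconstructedBundle

theorem mk_eq_mk_iff (hH : IsHolonomyMap EG H) {p p' : PwPathSpace EM x₀} {g g' : G} :
    mk H p g = mk H p' g' ↔ ∃ h : p.endpoint = p'.endpoint, g' = H (p.invComp p' h) * g :=
  hH.equivalence.quot_mk_eq_iff _ _

/-- The loop formed by the two paths factors through ℝ, hence is thin. This is the tool for all
later changes of representative by reparametrization or backtracking along one curve. -/
theorem mk_eq_mk_of_real (hH : IsHolonomyMap EG H) {p p' : PwPathSpace EM x₀} {s t : ℝ}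
    (A B : Path s t) {f : ℝ → M} (hf : Continuous f)
    (hp : ∀ i : I, p.eval i = f (A i)) (hp' : ∀ i : I, p'.eval i = f (B i)) (g : G) :
    mk H p g = mk H p' g := by
  obtain ⟨y, a⟩ := p
  obtain ⟨y', b⟩ := p'
  simp only [PwPathSpace.eval, Path.extend_extends'] at hp hp'
  obtain rfl : y = y' := by
    have h1 := hp 1
    have h2 := hp' 1
    simp only [Path.target] at h1 h2
    exact h1.trans h2.symm
  refine (mk_eq_mk_iff hH).2 ⟨rfl, ?_⟩
  rw [PwPathSpace.invComp_mk, hH.map_trans_symm_of_real A B hf hp hp', one_mul]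

theorem mk_injective (hH : IsHolonomyMap EG H) (p : PwPathSpace EM x₀) :
    Function.Injective (mk H p) := by
  intro g g' h
  obtain ⟨_, h⟩ := (mk_eq_mk_iff hH).1 h
  rw [h, hH.invComp_self, one_mul]

end ReconstructedBundle

end Classes

section Classes

variable {EM : Type*} [NormedAddCommGroup EM] [NormedSpace ℝ EM]
  {M : Type*} [TopologicalSpace M] [ChartedSpace EM M] {x₀ : M}
  {G : Type*} [Group G] {H : PwLoopSpace EM x₀ → G}

namespace ReconstructedBundle

theorem exists_eq_mk (a : ReconstructedBundle H) (p : PwPathSpace EM x₀)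
    (h : p.endpoint = a.proj) : ∃ g, a = mk H p g := by
  induction a using Quot.ind with
  | mk b => exact ⟨H (b.1.invComp p h.symm) * b.2, Quot.sound ⟨h.symm, rfl⟩⟩

@[simp] theorem proj_act (a : ReconstructedBundle H) (g : G) : (a.act g).proj = a.proj := by
  induction a using Quot.ind with
  | mk b => rfl

end ReconstructedBundle

end Classes

/-! ### Piecewise smooth families of curves over general parameter manifolds. -/

section PwSmooth

variable (EM : Type*) [NormedAddCommGroup EM] [NormedSpace ℝ EM]
  {M : Type*} [TopologicalSpace M] [ChartedSpace EM M]
  {EN : Type*} [NormedAddCommGroup EN] [NormedSpace ℝ EN]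
  {HN : Type*} [TopologicalSpace HN] (IN : ModelWithCorners ℝ EN HN)
  {N : Type*} [TopologicalSpace N] [ChartedSpace HN N]
  {EK : Type*} [NormedAddCommGroup EK] [NormedSpace ℝ EK]
  {HK : Type*} [TopologicalSpace HK] {IK : ModelWithCorners ℝ EK HK}
  {K : Type*} [TopologicalSpace K] [ChartedSpace HK K]

/-- Smooth families of curves over `[0,1]`, with common break points, for parameters in a subset of
a manifold with arbitrary model. -/
def PwSmoothOn (V : Set N) (F : N × ℝ → M) : Prop :=
  ContinuousOn F (V ×ˢ Icc (0 : ℝ) 1) ∧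
  ∃ B : Finset ℝ, ∀ a b : ℝ, 0 ≤ a → a < b → b ≤ 1 → (∀ c ∈ B, c ∉ Ioo a b) →
    ContMDiffOn (IN.prod 𝓘(ℝ, ℝ)) 𝓘(ℝ, EM) ∞ F (V ×ˢ Icc a b)

variable {EM IN} {V : Set N} {F : N × ℝ → M}

theorem PwSmoothOn.of_contMDiffOn
    (h : ContMDiffOn (IN.prod 𝓘(ℝ, ℝ)) 𝓘(ℝ, EM) ∞ F (V ×ˢ Icc (0 : ℝ) 1)) :
    PwSmoothOn EM IN V F :=
  ⟨h.continuousOn, ∅, fun _ _ ha _ hb _ => h.mono (prod_mono_right (Icc_subset_Icc ha hb))⟩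

theorem PwSmoothOn.comp (h : PwSmoothOn EM IN V F) {V' : Set K} {θ : K → N}
    (hθ : ContMDiffOn IK IN ∞ θ V') (hV : MapsTo θ V' V) :
    PwSmoothOn EM IK V' (fun z => F (θ z.1, z.2)) := by
  obtain ⟨hc, B, hB⟩ := h
  have hθ' : ∀ s : Set ℝ, ContMDiffOn (IK.prod 𝓘(ℝ, ℝ)) (IN.prod 𝓘(ℝ, ℝ)) ∞
      (fun z : K × ℝ => (θ z.1, z.2)) (V' ×ˢ s) := fun s =>
    (hθ.comp contMDiffOn_fst (fun z hz => hz.1)).prodMk contMDiffOn_snd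
  exact ⟨hc.comp (hθ' _).continuousOn fun z hz => ⟨hV hz.1, hz.2⟩, B, fun a b ha hab hb hcB =>
    (hB a b ha hab hb hcB).comp (hθ' _) fun z hz => ⟨hV hz.1, hz.2⟩⟩

theorem PwSmoothOn.mono (h : PwSmoothOn EM IN V F) {V' : Set N} (hV : V' ⊆ V) :
    PwSmoothOn EM IN V' F :=
  h.comp contMDiffOn_id hV

/-- An affine change of the curve parameter, as a smooth map on the parameters of a family. -/
theorem contMDiff_prodMk_affine (x y : ℝ) : ContMDiff (IN.prod 𝓘(ℝ, ℝ)) (IN.prod 𝓘(ℝ, ℝ)) ∞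
    (fun z : N × ℝ => (z.1, x * z.2 + y)) := by
  have h : ContMDiff 𝓘(ℝ, ℝ) 𝓘(ℝ, ℝ) ∞ (fun t : ℝ => x * t + y) :=
    ((contDiff_const.mul contDiff_id).add contDiff_const).contMDiff
  exact contMDiff_fst.prodMk (h.comp contMDiff_snd)

theorem PwSmoothOn.symm (h : PwSmoothOn EM IN V F) :
    PwSmoothOn EM IN V (fun z => F (z.1, 1 - z.2)) := by
  classical
  obtain ⟨hc, B, hB⟩ := h
  have hθ := contMDiff_prodMk_affine (IN := IN) (N := N) (-1) 1
  have hF : (fun z : N × ℝ => F (z.1, 1 - z.2)) = F ∘ (fun z : N × ℝ => (z.1, -1 * z.2 + 1)) := by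
    ext z
    simp [sub_eq_neg_add]
  rw [hF]
  refine ⟨hc.comp hθ.continuous.continuousOn fun z hz =>
    ⟨hz.1, by linarith [hz.2.2], by linarith [hz.2.1]⟩,
    B.image (fun t => 1 - t), fun a b ha hab hb hcB => ?_⟩
  refine (hB (1 - b) (1 - a) (by linarith) (by linarith) (by linarith) fun c hc hcI =>
    hcB (1 - c) (Finset.mem_image_of_mem _ hc) ⟨by linarith [hcI.2], by linarith [hcI.1]⟩).comp
    hθ.contMDiffOn fun z hz => ⟨hz.1, by linarith [hz.2.2], by linarith [hz.2.1]⟩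

theorem PwSmoothOn.trans {F₁ F₂ : N × ℝ → M} (h₁ : PwSmoothOn EM IN V F₁)
    (h₂ : PwSmoothOn EM IN V F₂)
    (hF₁ : ∀ u ∈ V, ∀ t ∈ Icc (0 : ℝ) (1 / 2), F (u, t) = F₁ (u, 2 * t))
    (hF₂ : ∀ u ∈ V, ∀ t ∈ Icc (1 / 2 : ℝ) 1, F (u, t) = F₂ (u, 2 * t - 1)) :
    PwSmoothOn EM IN V F := by
  classical
  obtain ⟨hc, B, hB⟩ := h₁
  obtain ⟨hc', B', hB'⟩ := h₂
  have hθ := contMDiff_prodMk_affine (IN := IN) (N := N) 2 0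
  have hθ' := contMDiff_prodMk_affine (IN := IN) (N := N) 2 (-1)
  refine ⟨?_, {1 / 2} ∪ (B.image (fun t => t / 2) ∪ B'.image (fun t => (t + 1) / 2)),
    fun a b ha hab hb hcB => ?_⟩
  · have c1 : ContinuousOn F (V ×ˢ Icc (0 : ℝ) (1 / 2)) :=
      (hc.comp (t := V ×ˢ Icc (0 : ℝ) 1) hθ.continuous.continuousOn fun z hz =>
        ⟨hz.1, by linarith [hz.2.1], by linarith [hz.2.2]⟩).congr fun z hz => by
          simpa using hF₁ z.1 hz.1 z.2 hz.2
    have c2 : ContinuousOn F (V ×ˢ Icc (1 / 2 : ℝ) 1) :=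
      (hc'.comp (t := V ×ˢ Icc (0 : ℝ) 1) hθ'.continuous.continuousOn fun z hz =>
        ⟨hz.1, by linarith [hz.2.1], by linarith [hz.2.2]⟩).congr fun z hz => by
          simpa [sub_eq_add_neg] using hF₂ z.1 hz.1 z.2 hz.2
    intro z hz
    rcases lt_trichotomy z.2 (1 / 2) with h | h | h
    · refine (c1 z ⟨hz.1, hz.2.1, h.le⟩).mono_of_mem_nhdsWithin ?_
      have : {w : N × ℝ | w.2 < 1 / 2} ∈ 𝓝 z :=
        (isOpen_lt continuous_snd continuous_const).mem_nhds h
      filter_upwards [mem_nhdsWithin_of_mem_nhds this, self_mem_nhdsWithin] with w h1 h2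
      exact ⟨h2.1, h2.2.1, le_of_lt h1⟩
    · have := (c1 z ⟨hz.1, hz.2.1, h.le⟩).union (c2 z ⟨hz.1, h.ge, hz.2.2⟩)
      rwa [← prod_union, Icc_union_Icc_eq_Icc (by norm_num) (by norm_num)] at this
    · refine (c2 z ⟨hz.1, h.le, hz.2.2⟩).mono_of_mem_nhdsWithin ?_
      have : {w : N × ℝ | 1 / 2 < w.2} ∈ 𝓝 z :=
        (isOpen_lt continuous_const continuous_snd).mem_nhds h
      filter_upwards [mem_nhdsWithin_of_mem_nhds this, self_mem_nhdsWithin] with w h1 h2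
      exact ⟨h2.1, le_of_lt h1, h2.2.2⟩
  · have hhalf : b ≤ 1 / 2 ∨ 1 / 2 ≤ a := by
      by_contra! hcon
      exact hcB (1 / 2) (by simp) ⟨hcon.2, hcon.1⟩
    rcases hhalf with hb2 | ha2
    · refine ((hB (2 * a) (2 * b) (by linarith) (by linarith) (by linarith) fun c hcB' hcI =>
        hcB (c / 2) (Finset.mem_union_right _ (Finset.mem_union_left _
          (Finset.mem_image_of_mem _ hcB'))) ⟨by linarith [hcI.1], by linarith [hcI.2]⟩).comp
        hθ.contMDiffOn (t := V ×ˢ Icc (2 * a) (2 * b)) fun z hz =>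
          ⟨hz.1, by linarith [hz.2.1], by linarith [hz.2.2]⟩).congr fun z hz => ?_
      simpa using hF₁ z.1 hz.1 z.2 ⟨ha.trans hz.2.1, hz.2.2.trans hb2⟩
    · refine ((hB' (2 * a - 1) (2 * b - 1) (by linarith) (by linarith) (by linarith)
        fun c hcB' hcI =>
        hcB ((c + 1) / 2) (Finset.mem_union_right _ (Finset.mem_union_right _
          (Finset.mem_image_of_mem (fun t => (t + 1) / 2) hcB')))
          ⟨by linarith [hcI.1], by linarith [hcI.2]⟩).comp
        hθ'.contMDiffOn (t := V ×ˢ Icc (2 * a - 1) (2 * b - 1)) fun z hz =>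
          ⟨hz.1, by linarith [hz.2.1], by linarith [hz.2.2]⟩).congr fun z hz => ?_
      simpa [sub_eq_add_neg] using hF₂ z.1 hz.1 z.2 ⟨ha2.trans hz.2.1, hz.2.2.trans hb⟩

-- Break points other than `j` stay at a positive distance, and `j` itself, being an end of the
-- interval, is not in its interior. This isolates a smooth piece on one side of a possible corner.
open Filter in
theorem eventually_forall_notMem_Ioo (B : Finset ℝ) (j d : ℝ) :
    ∀ᶠ δ : ℝ in 𝓝[>] 0, ∀ c ∈ B, c ∉ uIoo j (j + d * δ) := by
  rw [Finset.eventually_all]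
  intro c _
  rcases eq_or_ne c j with rfl | hc
  · refine Eventually.of_forall fun δ h => ?_
    rw [uIoo, mem_Ioo] at h
    simp at h
    exact h.1.not_gt h.2
  · have hlim : Tendsto (fun δ : ℝ => j + d * δ) (𝓝[>] 0) (𝓝 j) := by
      have : Continuous fun δ : ℝ => j + d * δ := by fun_prop
      simpa using (this.tendsto 0).mono_left nhdsWithin_le_nhds
    rcases lt_or_gt_of_ne hc with h | h
    · filter_upwards [hlim.eventually_const_lt h] with δ hδ hmem
      exact absurd hmem.1 (not_lt.2 (le_inf h.le hδ.le))
    · filter_upwards [hlim.eventually_lt_const h] with δ hδ hmem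
      exact absurd hmem.2 (not_lt.2 (sup_le h.le hδ.le))

/-- Some last piece [1 - δ, 1] has no break point inside, and smoothness there restricts to t = 1.
-/
theorem PwSmoothOn.contMDiffOn_one (h : PwSmoothOn EM IN V F) :
    ContMDiffOn IN 𝓘(ℝ, EM) ∞ (fun u => F (u, 1)) V := by
  obtain ⟨-, B, hB⟩ := h
  obtain ⟨δ, hδ, h0, h1⟩ := ((eventually_forall_notMem_Ioo B 1 (-1)).and
    (Ioo_mem_nhdsGT (zero_lt_one' ℝ))).exists
  have hlt : 1 + -1 * δ < 1 := by linarith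
  refine (hB (1 + -1 * δ) 1 (by linarith) hlt le_rfl fun c hc hcI => hδ c hc ?_).comp
    (contMDiff_id.prodMk contMDiff_const).contMDiffOn fun u hu => ⟨hu, hlt.le, le_rfl⟩
  rwa [uIoo, inf_eq_right.2 hlt.le, sup_eq_left.2 hlt.le]

end PwSmooth

/-! ### Prolonging paths and forming loops, in smooth families. -/

section Glue

variable {EM : Type*} [NormedAddCommGroup EM] [NormedSpace ℝ EM]
  {M : Type*} [TopologicalSpace M] [ChartedSpace EM M] {x₀ : M}
  {EN : Type*} [NormedAddCommGroup EN] [NormedSpace ℝ EN]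
  {HN : Type*} [TopologicalSpace HN] {IN : ModelWithCorners ℝ EN HN}
  {N : Type*} [TopologicalSpace N] [ChartedSpace HN N]

/-- A smooth curve over `[0,1]`, as a path. -/
def PwPath.ofSmooth {f : ℝ → M} (hf : ContMDiffOn 𝓘(ℝ, ℝ) 𝓘(ℝ, EM) ∞ f (Icc 0 1)) {y : M}
    (hy : f 0 = y) : PwPath EM y (f 1) where
  toPath :=
    { toFun := fun t => f t
      continuous_toFun := hf.continuousOn.comp_continuous continuous_subtype_val fun t => t.2
      source' := by simpa using hy
      target' := by simp }
  smooth := ⟨∅, fun a b ha _ hb _ => (hf.mono (Icc_subset_Icc ha hb)).congr fun t ht =>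
    Path.extend_apply _ ⟨ha.trans ht.1, ht.2.trans hb⟩⟩

/-- A curve that is smooth over `[0,1]` and can be attached to the path `p`. -/
def PwPathSpace.Attachable (p : PwPathSpace EM x₀) (f : ℝ → M) : Prop :=
  ContMDiffOn 𝓘(ℝ, ℝ) 𝓘(ℝ, EM) ∞ f (Icc 0 1) ∧ f 0 = p.endpoint

open Classical in
/-- First the path `p`, then the smooth curve `f` over `[0,1]`. -/
noncomputable def PwPathSpace.glue (p : PwPathSpace EM x₀) (f : ℝ → M) : PwPathSpace EM x₀ :=
  if h : p.Attachable f then ⟨f 1, p.2.trans (PwPath.ofSmooth h.1 h.2)⟩ else p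

namespace PwPathSpace

theorem glue_eq {p : PwPathSpace EM x₀} {f : ℝ → M} (h : p.Attachable f) :
    p.glue f = ⟨f 1, p.2.trans (PwPath.ofSmooth h.1 h.2)⟩ := dif_pos h

theorem endpoint_glue {p : PwPathSpace EM x₀} {f : ℝ → M} (h : p.Attachable f) :
    (p.glue f).endpoint = f 1 := by rw [glue_eq h]; rfl

theorem eval_glue_left {p : PwPathSpace EM x₀} {f : ℝ → M} (h : p.Attachable f) {t : ℝ}
    (ht : t ≤ 1 / 2) : (p.glue f).eval t = p.eval (2 * t) := by
  rw [glue_eq h]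
  exact Path.extend_trans_of_le_half _ _ ht

theorem eval_glue_right {p : PwPathSpace EM x₀} {f : ℝ → M} (h : p.Attachable f) {t : ℝ}
    (ht : t ∈ Icc (1 / 2 : ℝ) 1) : (p.glue f).eval t = f (2 * t - 1) := by
  rw [glue_eq h]
  refine (Path.extend_trans_of_half_le _ _ ht.1).trans ?_
  exact Path.extend_apply _ ⟨by linarith [ht.1], by linarith [ht.2]⟩

theorem eval_one (p : PwPathSpace EM x₀) : p.eval 1 = p.endpoint := p.2.toPath.extend_one

theorem continuous_eval (p : PwPathSpace EM x₀) : Continuous p.eval := p.2.toPath.continuous_extend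

theorem eval_contract (p : PwPathSpace EM x₀) {i t : ℝ} (hi : i ∈ Icc (0 : ℝ) 1)
    (ht : t ∈ Icc (0 : ℝ) 1) : (p.contract i).eval t = p.eval (i * t) := by
  refine (contractPath_extend _ _ ht).trans ?_
  rw [projIcc_of_mem _ hi]
  rfl

variable (IN) in
/-- A smooth family of paths, for parameters in a subset of a manifold with arbitrary model. -/
def IsSmoothFamily (V : Set N) (ψ : N → PwPathSpace EM x₀) : Prop :=
  PwSmoothOn EM IN V (fun z => (ψ z.1).eval z.2)

theorem IsSmoothFamily.endpoint {V : Set N} {ψ : N → PwPathSpace EM x₀}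
    (h : IsSmoothFamily IN V ψ) : ContMDiffOn IN 𝓘(ℝ, EM) ∞ (fun u => (ψ u).endpoint) V := by
  simpa only [eval_one] using PwSmoothOn.contMDiffOn_one h

theorem IsSmoothFamily.glue {V : Set N} {ψ : N → PwPathSpace EM x₀} (h : IsSmoothFamily IN V ψ)
    {f : N → ℝ → M}
    (hf : ContMDiffOn (IN.prod 𝓘(ℝ, ℝ)) 𝓘(ℝ, EM) ∞ (fun z : N × ℝ => f z.1 z.2)
      (V ×ˢ Icc (0 : ℝ) 1)) (hf0 : ∀ u ∈ V, f u 0 = (ψ u).endpoint) :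
    (∀ u ∈ V, (ψ u).Attachable (f u)) ∧ IsSmoothFamily IN V (fun u => (ψ u).glue (f u)) := by
  have hatt : ∀ u ∈ V, (ψ u).Attachable (f u) := fun u hu =>
    ⟨hf.comp (contMDiff_const.prodMk contMDiff_id).contMDiffOn fun t ht => ⟨hu, ht⟩, hf0 u hu⟩
  exact ⟨hatt, PwSmoothOn.trans h (PwSmoothOn.of_contMDiffOn hf)
    (fun u hu t ht => eval_glue_left (hatt u hu) ht.2)
    (fun u hu t ht => eval_glue_right (hatt u hu) ht)⟩

theorem isSmoothFamily_const (V : Set N) (p : PwPathSpace EM x₀) :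
    IsSmoothFamily IN V (fun _ => p) := by
  refine ⟨p.continuous_eval.comp_continuousOn continuousOn_snd, ?_⟩
  obtain ⟨B, hB⟩ := p.2.smooth
  exact ⟨B, fun a b ha hab hb hc => (hB a b ha hab hb hc).comp contMDiffOn_snd fun z hz => hz.2⟩

open Classical in
/-- The loop `p⁻¹ ∘ p'`, or a constant loop if `p` and `p'` end at different points. -/
noncomputable def loop (p p' : PwPathSpace EM x₀) : PwLoopSpace EM x₀ :=
  if h : p.endpoint = p'.endpoint then p.invComp p' h
  else ⟨Path.refl x₀, ∅, fun _ _ _ _ _ _ => contMDiffOn_const⟩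

theorem loop_eq {p p' : PwPathSpace EM x₀} (h : p.endpoint = p'.endpoint) :
    p.loop p' = p.invComp p' h := dif_pos h

theorem eval_ofLoop_loop_left {p p' : PwPathSpace EM x₀} (h : p.endpoint = p'.endpoint) {t : ℝ}
    (ht : t ≤ 1 / 2) : (ofLoop (p.loop p')).eval t = p'.eval (2 * t) := by
  rw [loop_eq h]
  exact Path.extend_trans_of_le_half _ _ ht

theorem eval_ofLoop_loop_right {p p' : PwPathSpace EM x₀} (h : p.endpoint = p'.endpoint) {t : ℝ}
    (ht : 1 / 2 ≤ t) : (ofLoop (p.loop p')).eval t = p.eval (1 - (2 * t - 1)) := by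
  rw [loop_eq h]
  obtain ⟨y, a⟩ := p
  obtain ⟨y', b⟩ := p'
  obtain rfl : y = y' := h
  refine (Path.extend_trans_of_half_le _ _ ht).trans ?_
  exact Path.extend_symm_apply _ _

theorem IsSmoothFamily.loop {V : Set N} {ψ ψ' : N → PwPathSpace EM x₀}
    (h : IsSmoothFamily IN V ψ) (h' : IsSmoothFamily IN V ψ')
    (he : ∀ u ∈ V, (ψ u).endpoint = (ψ' u).endpoint) :
    IsSmoothFamily IN V (fun u => ofLoop ((ψ u).loop (ψ' u))) :=
  PwSmoothOn.trans h' (PwSmoothOn.symm h)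
    (fun u hu _ ht => eval_ofLoop_loop_left (he u hu) ht.2)
    (fun u hu _ ht => eval_ofLoop_loop_right (he u hu) ht.1)

end PwPathSpace

end Glue

/-! ### Classes of prolonged paths. -/

section Classes

variable {EM : Type*} [NormedAddCommGroup EM] [NormedSpace ℝ EM]
  {M : Type*} [TopologicalSpace M] [ChartedSpace EM M] {x₀ : M}
  {EG : Type*} [NormedAddCommGroup EG] [NormedSpace ℝ EG]
  {G : Type*} [TopologicalSpace G] [ChartedSpace EG G] [Group G] {H : PwLoopSpace EM x₀ → G}

namespace ReconstructedBundle

open PwPathSpace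

/-- The comparison loop only gains `f` and its return, which cancel. Therefore transport along `f`
is defined on classes. -/
theorem mk_glue_congr (hH : IsHolonomyMap EG H) {p p' : PwPathSpace EM x₀} {g g' : G}
    (h : mk H p g = mk H p' g') (f : ℝ → M) : mk H (p.glue f) g = mk H (p'.glue f) g' := by
  have h0 := h
  obtain ⟨y, a⟩ := p
  obtain ⟨y', b⟩ := p'
  obtain ⟨rfl : y = y', hg⟩ := (mk_eq_mk_iff hH).1 h
  by_cases hf : Attachable (⟨y, a⟩ : PwPathSpace EM x₀) f
  · have hf' : Attachable (⟨y, b⟩ : PwPathSpace EM x₀) f := hf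
    rw [glue_eq hf, glue_eq hf']
    refine (mk_eq_mk_iff hH).2 ⟨rfl, hg.trans ?_⟩
    exact congrArg (· * g) (hH.map_trans_trans_symm a b _).symm
  -- Attachability depends only on the common end point, so both sides take the default value of
  -- `glue` together.
  · have hf' : ¬ Attachable (⟨y, b⟩ : PwPathSpace EM x₀) f := hf
    rwa [show glue ⟨y, a⟩ f = _ from dif_neg hf, show glue ⟨y, b⟩ f = _ from dif_neg hf']

/-- Both paths follow `r` from parameter 0 to `i`, the second one by way of `j`, so their loop
factors through ℝ. Contractions, whose break points move with `i`, are thus replaced by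
prolongations of one fixed path. -/
theorem mk_contract_eq_mk_glue (hH : IsHolonomyMap EG H) (r : PwPathSpace EM x₀) {i j : ℝ}
    (hi : i ∈ Icc (0 : ℝ) 1) (hj : j ∈ Icc (0 : ℝ) 1) {ρ : ℝ → ℝ} (hρ : Continuous ρ)
    (h0 : ρ 0 = j) (h1 : ρ 1 = i) {f : ℝ → M} (hfρ : ∀ t ∈ Icc (0 : ℝ) 1, f t = r.eval (ρ t))
    (hf : ContMDiffOn 𝓘(ℝ, ℝ) 𝓘(ℝ, EM) ∞ f (Icc 0 1)) (g : G) :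
    mk H (r.contract i) g = mk H ((r.contract j).glue f) g := by
  have hatt : (r.contract j).Attachable f :=
    ⟨hf, (hfρ 0 ⟨le_rfl, zero_le_one⟩).trans (congrArg r.eval h0)⟩
  let R : Path j i :=
    { toFun := fun t => ρ t
      continuous_toFun := by fun_prop
      source' := by simpa using h0
      target' := by simpa using h1 }
  refine mk_eq_mk_of_real hH (realSegment 0 i) ((realSegment 0 j).trans R) r.continuous_eval
    (fun t => ?_) (fun t => ?_) g
  · rw [eval_contract r hi t.2, realSegment_apply]
    congr 1
    ring
  · rw [Path.trans_apply]
    split_ifs with ht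
    · rw [eval_glue_left hatt ht, eval_contract r hj ⟨by linarith [t.2.1], by linarith⟩,
        realSegment_apply]
      congr 1
      simp only []
      ring
    · exact (eval_glue_right hatt ⟨(not_le.1 ht).le, t.2.2⟩).trans
        (hfρ _ ⟨by linarith, by linarith [t.2.2]⟩)

theorem mk_glue_const (hH : IsHolonomyMap EG H) (p : PwPathSpace EM x₀) (g : G) :
    mk H (p.glue fun _ => p.endpoint) g = mk H p g := by
  have hatt : p.Attachable fun _ => p.endpoint := ⟨contMDiffOn_const, rfl⟩
  refine mk_eq_mk_of_real hH ((realSegment 0 1).trans (Path.refl 1)) (realSegment 0 1)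
    p.continuous_eval (fun t => ?_) (fun t => ?_) g
  · rw [Path.trans_apply]
    split_ifs with ht
    · rw [eval_glue_left hatt ht, realSegment_apply]
      congr 1
      simp
    · rw [eval_glue_right hatt ⟨(not_le.1 ht).le, t.2.2⟩, Path.refl_apply, eval_one]
  · rw [realSegment_apply]
    congr 1
    simp

theorem mk_eq_mk_mul_loop (hH : IsHolonomyMap EG H) {p p' : PwPathSpace EM x₀}
    (h : p.endpoint = p'.endpoint) (g : G) : mk H p g = mk H p' (H (p.loop p') * g) :=
  (mk_eq_mk_iff hH).2 ⟨h, by rw [loop_eq h]⟩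

end ReconstructedBundle

end Classes

/-! ### Smoothness of the holonomy over manifolds of parameters. -/

section HolonomySmooth

open PwPathSpace

variable {EM : Type*} [NormedAddCommGroup EM] [NormedSpace ℝ EM]
  {M : Type*} [TopologicalSpace M] [ChartedSpace EM M] {x₀ : M}
  {EG : Type*} [NormedAddCommGroup EG] [NormedSpace ℝ EG]
  {G : Type*} [TopologicalSpace G] [ChartedSpace EG G] [Group G] {H : PwLoopSpace EM x₀ → G}
  {EN : Type*} [NormedAddCommGroup EN] [NormedSpace ℝ EN] [FiniteDimensional ℝ EN]
  {HN : Type*} [TopologicalSpace HN] {IN : ModelWithCorners ℝ EN HN} [IN.Boundaryless]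
  {N : Type*} [TopologicalSpace N] [ChartedSpace HN N] [IsManifold IN ∞ N]

/-- A holonomy map is smooth along families of loops that are indexed by any finite-dimensional
manifold. -/
theorem IsHolonomyMap.contMDiffOn (hH : IsHolonomyMap EG H) {V : Set N} (hV : IsOpen V)
    {Ω : N → PwLoopSpace EM x₀} (hΩ : IsSmoothFamily IN V fun u => ofLoop (Ω u)) :
    ContMDiffOn IN 𝓘(ℝ, EG) ∞ (fun u => H (Ω u)) V := by
  intro u₀ hu₀
  refine ContMDiffAt.contMDiffWithinAt ?_
  let e := extChartAt IN u₀
  -- The smoothness axiom speaks of open subsets of Euclidean space, so the chart is followed by a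
  -- linear identification of the model space with it.
  let L : EN ≃L[ℝ] EuclideanSpace ℝ (Fin (Module.finrank ℝ EN)) := toEuclidean
  let U : Set (EuclideanSpace ℝ (Fin (Module.finrank ℝ EN))) := L.symm ⁻¹' (e.target ∩ e.symm ⁻¹' V)
  have hUo : IsOpen U :=
    ((continuousOn_extChartAt_symm u₀).isOpen_inter_preimage (isOpen_extChartAt_target u₀)
      hV).preimage L.symm.continuous
  have hθ : ContMDiffOn 𝓘(ℝ, EuclideanSpace ℝ (Fin (Module.finrank ℝ EN))) IN ∞
      (fun z => e.symm (L.symm z)) U :=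
    (contMDiffOn_extChartAt_symm u₀).comp L.symm.contDiff.contMDiff.contMDiffOn fun z hz => hz.1
  -- For the trivial model, `IsSmoothFamily` unfolds to the `IsSmoothFamilyOn` of the axiom.
  have h1 := hH.smooth _ U hUo (fun z => Ω (e.symm (L.symm z)))
    (PwSmoothOn.comp hΩ hθ fun z hz => hz.2)
  have hmem : L (e u₀) ∈ U := by
    simp only [U, mem_preimage, L.symm_apply_apply]
    exact ⟨mem_extChartAt_target u₀, by rwa [mem_preimage, extChartAt_to_inv]⟩
  have h2 : ContMDiffAt IN 𝓘(ℝ, EuclideanSpace ℝ (Fin (Module.finrank ℝ EN))) ∞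
      (fun u => L (e u)) u₀ :=
    L.contDiff.contMDiff.contMDiffAt.comp u₀ contMDiffAt_extChartAt
  refine (((h1.contMDiffAt (hUo.mem_nhds hmem)).comp u₀ h2)).congr_of_eventuallyEq ?_
  filter_upwards [show e.source ∈ 𝓝 u₀ from extChartAt_source_mem_nhds u₀] with u hu
  simp only [Function.comp_apply, L.symm_apply_apply]
  rw [e.left_inv hu]

theorem IsHolonomyMap.contMDiffOn_loop (hH : IsHolonomyMap EG H) {V : Set N} (hV : IsOpen V)
    {ψ ψ' : N → PwPathSpace EM x₀} (h : IsSmoothFamily IN V ψ) (h' : IsSmoothFamily IN V ψ')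
    (he : ∀ u ∈ V, (ψ u).endpoint = (ψ' u).endpoint) :
    ContMDiffOn IN 𝓘(ℝ, EG) ∞ (fun u => H ((ψ u).loop (ψ' u))) V :=
  hH.contMDiffOn hV (h.loop h' he)

end HolonomySmooth

/-! ### Chart balls, coordinate segments and smooth local choices of paths. -/

section LocalSections

open PwPathSpace

variable {EM : Type*} [NormedAddCommGroup EM] [NormedSpace ℝ EM]
  {M : Type*} [TopologicalSpace M] [ChartedSpace EM M]

/-- A convex open subset of the target of the preferred chart at `x`, whose preimage in the manifold
is a contractible neighbourhood of `x`. -/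
structure IsChartBall (x : M) (B : Set EM) : Prop where
  isOpen : IsOpen B
  convex : Convex ℝ B
  subset : B ⊆ (chartAt EM x).target
  mem : chartAt EM x x ∈ B

theorem exists_isChartBall (x : M) : ∃ B : Set EM, IsChartBall x B := by
  obtain ⟨r, hr, hB⟩ := Metric.isOpen_iff.1 (chartAt EM x).open_target _ (mem_chart_target EM x)
  exact ⟨_, Metric.isOpen_ball, convex_ball _ _, hB, Metric.mem_ball_self hr⟩

/-- The part of the domain of the preferred chart at `x` that lies over `B`. -/
def chartDomain (x : M) (B : Set EM) : Set M := (chartAt EM x).source ∩ chartAt EM x ⁻¹' B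

namespace IsChartBall

variable {x : M} {B : Set EM}

theorem isOpen_chartDomain (h : IsChartBall x B) : IsOpen (chartDomain x B) :=
  (chartAt EM x).isOpen_inter_preimage h.isOpen

theorem mem_chartDomain (h : IsChartBall x B) : x ∈ chartDomain x B :=
  ⟨mem_chart_source EM x, h.mem⟩

theorem symm_mem (h : IsChartBall x B) {w : EM} (hw : w ∈ B) :
    (chartAt EM x).symm w ∈ chartDomain x B :=
  ⟨(chartAt EM x).map_target (h.subset hw), by
    rwa [mem_preimage, (chartAt EM x).right_inv (h.subset hw)]⟩

theorem contractibleSpace (h : IsChartBall x B) : ContractibleSpace (chartDomain x B) := by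
  have := h.convex.contractibleSpace ⟨_, h.mem⟩
  let e : chartDomain x B ≃ₜ B :=
    { toFun := fun u => ⟨chartAt EM x u, u.2.2⟩
      invFun := fun w => ⟨(chartAt EM x).symm w, h.symm_mem w.2⟩
      left_inv := fun u => Subtype.ext ((chartAt EM x).left_inv u.2.1)
      right_inv := fun w => Subtype.ext ((chartAt EM x).right_inv (h.subset w.2))
      continuous_toFun := ((chartAt EM x).continuousOn.comp_continuous continuous_subtype_val
        fun u => u.2.1).subtype_mk _
      continuous_invFun := ((chartAt EM x).continuousOn_symm.comp_continuous
        continuous_subtype_val fun w => h.subset w.2).subtype_mk _ }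
  exact e.contractibleSpace

end IsChartBall

variable {EN : Type*} [NormedAddCommGroup EN] [NormedSpace ℝ EN]
  {HN : Type*} [TopologicalSpace HN] {IN : ModelWithCorners ℝ EN HN}
  {N : Type*} [TopologicalSpace N] [ChartedSpace HN N]

/-- The curve that is the segment from `y` to `w` in the preferred chart at `x`, parametrized by the
square of the parameter. -/
def chartSegment (x : M) (y w : EM) (t : ℝ) : M := (chartAt EM x).symm (y + t ^ 2 • (w - y))

theorem chartSegment_zero (x : M) (y w : EM) : chartSegment x y w 0 = (chartAt EM x).symm y := by
  simp [chartSegment]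

theorem chartSegment_one (x : M) (y w : EM) : chartSegment x y w 1 = (chartAt EM x).symm w := by
  simp [chartSegment]

theorem contMDiffOn_chartSegment [IsManifold 𝓘(ℝ, EM) ∞ M] {x : M} {B : Set EM}
    (h : IsChartBall x B) {V : Set N} {y w : N → EM}
    (hy : ContMDiffOn IN 𝓘(ℝ, EM) ∞ y V) (hw : ContMDiffOn IN 𝓘(ℝ, EM) ∞ w V)
    (hyB : MapsTo y V B) (hwB : MapsTo w V B) :
    ContMDiffOn (IN.prod 𝓘(ℝ, ℝ)) 𝓘(ℝ, EM) ∞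
      (fun z : N × ℝ => chartSegment x (y z.1) (w z.1) z.2) (V ×ˢ Icc (0 : ℝ) 1) := by
  have h1 : ContMDiffOn (IN.prod 𝓘(ℝ, ℝ)) 𝓘(ℝ, EM) ∞ (fun z : N × ℝ => y z.1)
      (V ×ˢ Icc (0 : ℝ) 1) :=
    hy.comp contMDiffOn_fst fun z hz => hz.1
  have h2 : ContMDiffOn (IN.prod 𝓘(ℝ, ℝ)) 𝓘(ℝ, EM) ∞ (fun z : N × ℝ => w z.1)
      (V ×ˢ Icc (0 : ℝ) 1) :=
    hw.comp contMDiffOn_fst fun z hz => hz.1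
  have h3 : ContMDiffOn (IN.prod 𝓘(ℝ, ℝ)) 𝓘(ℝ, ℝ) ∞ (fun z : N × ℝ => z.2 ^ 2)
      (V ×ˢ Icc (0 : ℝ) 1) :=
    ((contDiff_id.pow 2).contMDiff.contMDiffOn (s := univ)).comp contMDiffOn_snd
      fun z _ => mem_univ _
  refine contMDiffOn_chart_symm.comp (h1.add (h3.smul (h2.sub h1))) fun z hz => h.subset ?_
  have := h.convex.add_smul_sub_mem (hyB hz.1) (hwB hz.1) (t := z.2 ^ 2)
    ⟨by positivity, pow_le_one₀ hz.2.1 hz.2.2⟩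
  exact this

theorem contMDiffOn_chart_chartDomain [IsManifold 𝓘(ℝ, EM) ∞ M] {x : M} {B : Set EM} :
    ContMDiffOn 𝓘(ℝ, EM) 𝓘(ℝ, EM) ∞ (chartAt EM x) (chartDomain x B) :=
  contMDiffOn_chart.mono inter_subset_left

/-- Prolonging paths by segments, in the chart of the end point. -/
theorem isSmoothFamily_glue_chartSegment [IsManifold 𝓘(ℝ, EM) ∞ M] {x₀ x : M} {B : Set EM}
    (h : IsChartBall x B) {V : Set N} {ψ : N → PwPathSpace EM x₀} (hψ : IsSmoothFamily IN V ψ)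
    (hV : ∀ u ∈ V, (ψ u).endpoint ∈ chartDomain x B) {w : N → EM}
    (hw : ContMDiffOn IN 𝓘(ℝ, EM) ∞ w V) (hwB : MapsTo w V B) :
    (∀ u ∈ V, (ψ u).Attachable (chartSegment x (chartAt EM x (ψ u).endpoint) (w u))) ∧
    IsSmoothFamily IN V
      fun u => (ψ u).glue (chartSegment x (chartAt EM x (ψ u).endpoint) (w u)) := by
  refine hψ.glue (contMDiffOn_chartSegment h (contMDiffOn_chart_chartDomain.comp hψ.endpoint hV) hw
    (fun u hu => (hV u hu).2) hwB) fun u hu => ?_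
  rw [chartSegment_zero, (chartAt EM x).left_inv (hV u hu).1]

/-- A chart ball is reached by piecewise smooth paths either entirely or not at all, since its
points can be joined by coordinate segments. The set of reachable points is therefore clopen, and it
contains `x₀`. -/
theorem exists_endpoint_eq [IsManifold 𝓘(ℝ, EM) ∞ M] [PreconnectedSpace M] (x₀ y : M) :
    ∃ p : PwPathSpace EM x₀, p.endpoint = y := by
  let A : Set M := {y | ∃ p : PwPathSpace EM x₀, p.endpoint = y}
  have hA : ∀ (x : M) (B : Set EM), IsChartBall x B → ∀ y ∈ chartDomain x B,
      ∀ z ∈ chartDomain x B, y ∈ A → z ∈ A := by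
    rintro x B h _ hy z hz ⟨p, rfl⟩
    obtain ⟨hatt, -⟩ := isSmoothFamily_glue_chartSegment (IN := 𝓘(ℝ, ℝ)) (N := ℝ) (V := univ) h
      (isSmoothFamily_const univ p) (fun _ _ => hy) (contMDiffOn_const (c := chartAt EM x z))
      (fun _ _ => hz.2)
    refine ⟨_, (endpoint_glue (hatt 0 (mem_univ _))).trans ?_⟩
    rw [chartSegment_one, (chartAt EM x).left_inv hz.1]
  have hclopen : IsClopen A := by
    constructor
    · refine isClosed_of_closure_subset fun x hx => ?_
      obtain ⟨B, h⟩ := exists_isChartBall (EM := EM) x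
      obtain ⟨y, hy, hyA⟩ := mem_closure_iff.1 hx _ h.isOpen_chartDomain h.mem_chartDomain
      exact hA x B h y hy x h.mem_chartDomain hyA
    · refine isOpen_iff_mem_nhds.2 fun x hx => ?_
      obtain ⟨B, h⟩ := exists_isChartBall (EM := EM) x
      filter_upwards [h.isOpen_chartDomain.mem_nhds h.mem_chartDomain] with y hy
      exact hA x B h x h.mem_chartDomain y hy hx
  have : A = univ := hclopen.eq_univ
    ⟨x₀, ⟨x₀, Path.refl x₀, ∅, fun _ _ _ _ _ _ => contMDiffOn_const⟩, rfl⟩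
  exact this.ge (mem_univ y)

variable (EM) in
/-- A smooth family of paths `ψ[u]` with `ψ[u](1) = u`, over an open subset of `M`. -/
structure LocalSection (x₀ : M) where
  base : Set M
  isOpen : IsOpen base
  toFun : M → PwPathSpace EM x₀
  smooth : IsSmoothFamily 𝓘(ℝ, EM) base toFun
  endpoint_eq : ∀ u ∈ base, (toFun u).endpoint = u

/-- A fixed path to the centre of the ball is followed by the coordinate segment to u. -/
theorem exists_localSection [IsManifold 𝓘(ℝ, EM) ∞ M] [PreconnectedSpace M] (x₀ : M) {x : M}
    {B : Set EM} (h : IsChartBall x B) :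
    ∃ s : LocalSection EM x₀, s.base = chartDomain x B := by
  obtain ⟨p, rfl⟩ := exists_endpoint_eq (EM := EM) x₀ x
  obtain ⟨hatt, hs⟩ := isSmoothFamily_glue_chartSegment h (isSmoothFamily_const _ p)
    (fun _ _ => h.mem_chartDomain) (contMDiffOn_chart_chartDomain (x := p.endpoint) (B := B))
    fun u hu => hu.2
  refine ⟨⟨chartDomain p.endpoint B, h.isOpen_chartDomain, _, hs, fun u hu => ?_⟩, rfl⟩
  rw [endpoint_glue (hatt u hu), chartSegment_one, (chartAt EM _).left_inv hu.1]

end LocalSections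

/-! ### The manifold structure of the total space. -/

section Charts

open PwPathSpace ReconstructedBundle

variable {EM : Type*} [NormedAddCommGroup EM] [NormedSpace ℝ EM]
  {M : Type*} [TopologicalSpace M] [ChartedSpace EM M] {x₀ : M}
  {G : Type*} [Group G] {H : PwLoopSpace EM x₀ → G}

theorem LocalSection.proj_triv (s : LocalSection EM x₀) {z : M × G} (hz : z.1 ∈ s.base) :
    (triv H s.toFun z).proj = z.1 :=
  s.endpoint_eq _ hz

end Charts

section Charts

open PwPathSpace ReconstructedBundle

variable {EM : Type*} [NormedAddCommGroup EM] [NormedSpace ℝ EM]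
  {M : Type*} [TopologicalSpace M] [ChartedSpace EM M] {x₀ : M}
  {EG : Type*} [NormedAddCommGroup EG] [NormedSpace ℝ EG]
  {G : Type*} [TopologicalSpace G] [ChartedSpace EG G] [Group G] {H : PwLoopSpace EM x₀ → G}

namespace LocalSection

variable (s s' : LocalSection EM x₀)

variable (H) in
/-- The change of trivialization between two smooth families of paths. -/
noncomputable def transition (z : M × G) : M × G :=
  (z.1, H ((s.toFun z.1).loop (s'.toFun z.1)) * z.2)

theorem triv_eq_triv_transition (hH : IsHolonomyMap EG H) {z : M × G} (h : z.1 ∈ s.base)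
    (h' : z.1 ∈ s'.base) : triv H s.toFun z = triv H s'.toFun (s.transition H s' z) :=
  mk_eq_mk_mul_loop hH ((s.endpoint_eq _ h).trans (s'.endpoint_eq _ h').symm) _

theorem contMDiffOn_transition [FiniteDimensional ℝ EM] [IsManifold 𝓘(ℝ, EM) ∞ M]
    [LieGroup 𝓘(ℝ, EG) ∞ G] (hH : IsHolonomyMap EG H) :
    ContMDiffOn (𝓘(ℝ, EM).prod 𝓘(ℝ, EG)) (𝓘(ℝ, EM).prod 𝓘(ℝ, EG)) ∞ (s.transition H s')
      ((s.base ∩ s'.base) ×ˢ univ) := by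
  have h := hH.contMDiffOn_loop (s.isOpen.inter s'.isOpen)
    (PwSmoothOn.mono s.smooth inter_subset_left) (PwSmoothOn.mono s'.smooth inter_subset_right)
    fun u hu => (s.endpoint_eq u hu.1).trans (s'.endpoint_eq u hu.2).symm
  exact contMDiffOn_fst.prodMk ((h.comp contMDiffOn_fst fun z hz => hz.1).mul contMDiffOn_snd)

theorem bijOn_triv (hH : IsHolonomyMap EG H) :
    BijOn (triv H s.toFun) (s.base ×ˢ univ) (proj ⁻¹' s.base) := by
  refine ⟨fun z hz => ?_, ?_, fun a ha => ?_⟩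
  · rw [mem_preimage, s.proj_triv hz.1]
    exact hz.1
  · rintro ⟨u, g⟩ hz ⟨u', g'⟩ hz' h
    obtain rfl : u = u' := (s.proj_triv hz.1).symm.trans
      ((congrArg proj h).trans (s.proj_triv hz'.1))
    exact congrArg (Prod.mk u) (mk_injective hH _ h)
  · obtain ⟨g, hg⟩ := exists_eq_mk a (s.toFun a.proj) (s.endpoint_eq _ ha)
    exact ⟨(a.proj, g), ⟨ha, mem_univ _⟩, hg.symm⟩

/-- The local trivialization `C_ψ`, as a bijection of `U × G` with `π⁻¹(U)`. -/
noncomputable def trivEquiv (hH : IsHolonomyMap EG H) :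
    PartialEquiv (M × G) (ReconstructedBundle H) :=
  haveI : Nonempty (M × G) := ⟨(x₀, 1)⟩
  (s.bijOn_triv hH).toPartialEquiv

variable (hH : IsHolonomyMap EG H)

theorem trivEquiv_apply (z : M × G) : s.trivEquiv hH z = triv H s.toFun z := rfl

theorem trivEquiv_symm_trivEquiv {z : M × G} (h : z.1 ∈ s.base) (h' : z.1 ∈ s'.base) :
    (s'.trivEquiv hH).symm (s.trivEquiv hH z) = s.transition H s' z := by
  rw [trivEquiv_apply, triv_eq_triv_transition s s' hH h h']
  exact (s'.trivEquiv hH).left_inv ⟨h', mem_univ _⟩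

/-- The chart of the total space that comes from a local trivialization and a chart of the base and
of the group. -/
noncomputable def chart (z : M × G) : PartialEquiv (ReconstructedBundle H) (ModelProd EM EG) :=
  (s.trivEquiv hH).symm.trans (chartAt (ModelProd EM EG) z).toPartialEquiv

theorem mem_chart_source_iff {z : M × G} {a : ReconstructedBundle H} :
    a ∈ (s.chart hH z).source ↔ a.proj ∈ s.base ∧
      (s.trivEquiv hH).symm a ∈ (chartAt (ModelProd EM EG) z).source := by
  rw [chart, PartialEquiv.trans_source]
  rfl

theorem mem_chart_target_iff {z : M × G} {w : ModelProd EM EG} :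
    w ∈ (s.chart hH z).target ↔ w ∈ (chartAt (ModelProd EM EG) z).target ∧
      ((chartAt (ModelProd EM EG) z).symm w).1 ∈ s.base := by
  rw [chart, PartialEquiv.trans_target]
  exact and_congr_right fun _ => ⟨fun h => h.1, fun h => ⟨h, mem_univ _⟩⟩

/-- Only product charts and `transition` occur on the right, so openness and smoothness of chart
changes can be checked while the total space has no topology yet. -/
theorem chartTransition_source (z z' : M × G) :
    ((s.chart hH z).symm.trans (s'.chart hH z')).source =
      (chartAt (ModelProd EM EG) z).target ∩ (chartAt (ModelProd EM EG) z).symm ⁻¹'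
        (((s.base ∩ s'.base) ×ˢ univ) ∩
          s.transition H s' ⁻¹' (chartAt (ModelProd EM EG) z').source) := by
  ext w
  rw [PartialEquiv.trans_source, PartialEquiv.symm_source, mem_inter_iff, mem_chart_target_iff,
    mem_preimage, mem_chart_source_iff]
  have hw : (s.chart hH z).symm w = s.trivEquiv hH ((chartAt (ModelProd EM EG) z).symm w) := rfl
  rw [hw]
  constructor
  · rintro ⟨⟨h1, h2⟩, h3, h4⟩
    rw [trivEquiv_apply, s.proj_triv h2] at h3
    rw [trivEquiv_symm_trivEquiv s s' hH h2 h3] at h4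
    exact ⟨h1, ⟨⟨h2, h3⟩, mem_univ _⟩, h4⟩
  · rintro ⟨h1, ⟨⟨h2, h3⟩, -⟩, h4⟩
    rw [trivEquiv_symm_trivEquiv s s' hH h2 h3, trivEquiv_apply, s.proj_triv h2]
    exact ⟨⟨h1, h2⟩, h3, h4⟩

variable [FiniteDimensional ℝ EM] [IsManifold 𝓘(ℝ, EM) ∞ M] [LieGroup 𝓘(ℝ, EG) ∞ G]

theorem contMDiffOn_chartTransition (z z' : M × G) :
    ContMDiffOn (𝓘(ℝ, EM).prod 𝓘(ℝ, EG)) (𝓘(ℝ, EM).prod 𝓘(ℝ, EG)) ∞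
      ((s.chart hH z).symm.trans (s'.chart hH z'))
      ((s.chart hH z).symm.trans (s'.chart hH z')).source := by
  rw [chartTransition_source]
  refine ((contMDiffOn_chart (x := z')).comp ((s.contMDiffOn_transition s' hH).comp
    ((contMDiffOn_chart_symm (x := z)).mono inter_subset_left) fun w hw => hw.2.1)
    fun w hw => hw.2.2).congr fun w hw => ?_
  exact congrArg (chartAt (ModelProd EM EG) z')
    (trivEquiv_symm_trivEquiv s s' hH hw.2.1.1.1 hw.2.1.1.2)

theorem isOpen_chartTransition_source (z z' : M × G) :
    IsOpen ((s.chart hH z).symm.trans (s'.chart hH z')).source := by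
  rw [chartTransition_source]
  refine (chartAt (ModelProd EM EG) z).isOpen_inter_preimage_symm ?_
  exact (s.contMDiffOn_transition s' hH).continuousOn.isOpen_inter_preimage
    ((s.isOpen.inter s'.isOpen).prod isOpen_univ) (chartAt (ModelProd EM EG) z').open_source

end LocalSection

section

variable [IsManifold 𝓘(ℝ, EM) ∞ M] [PreconnectedSpace M]

theorem exists_mem_chart_source (hH : IsHolonomyMap EG H) (a : ReconstructedBundle H) :
    ∃ (s : LocalSection EM x₀) (z : M × G), a ∈ (s.chart hH z).source := by
  obtain ⟨B, h⟩ := exists_isChartBall (EM := EM) a.proj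
  obtain ⟨s, hs⟩ := exists_localSection x₀ h
  exact ⟨s, _, (s.mem_chart_source_iff hH).2 ⟨hs ▸ h.mem_chartDomain, mem_chart_source _ _⟩⟩

variable [FiniteDimensional ℝ EM] [LieGroup 𝓘(ℝ, EG) ∞ G]

/-- The atlas of the total space, before it has a topology. -/
noncomputable def chartedSpaceCore (hH : IsHolonomyMap EG H) :
    ChartedSpaceCore (ModelProd EM EG) (ReconstructedBundle H) where
  -- Every smooth local section is admitted, not just one for each point; this is what makes every
  -- C_ψ a diffeomorphism and not only some chosen ones.
  atlas := {e | ∃ (s : LocalSection EM x₀) (z : M × G), e = s.chart hH z}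
  chartAt a := (exists_mem_chart_source hH a).choose.chart hH
    (exists_mem_chart_source hH a).choose_spec.choose
  mem_chart_source a := (exists_mem_chart_source hH a).choose_spec.choose_spec
  chart_mem_atlas a := ⟨_, _, rfl⟩
  open_source := by
    rintro _ _ ⟨s, z, rfl⟩ ⟨s', z', rfl⟩
    exact s.isOpen_chartTransition_source s' hH z z'
  continuousOn_toFun := by
    rintro _ _ ⟨s, z, rfl⟩ ⟨s', z', rfl⟩
    exact (s.contMDiffOn_chartTransition s' hH z z').continuousOn

theorem exists_hasReconstructedCharts (hH : IsHolonomyMap EG H) :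
    ∃ (_ : TopologicalSpace (ReconstructedBundle H))
       (_ : ChartedSpace (ModelProd EM EG) (ReconstructedBundle H))
       (_ : IsManifold (𝓘(ℝ, EM).prod 𝓘(ℝ, EG)) ∞ (ReconstructedBundle H)),
      ReconstructedBundle.HasReconstructedCharts EG H := by
  let c := chartedSpaceCore hH
  let _ : TopologicalSpace (ReconstructedBundle H) := c.toTopologicalSpace
  let _ : ChartedSpace (ModelProd EM EG) (ReconstructedBundle H) := c.toChartedSpace
  have hatlas : ∀ e ∈ atlas (ModelProd EM EG) (ReconstructedBundle H),
      ∃ (s : LocalSection EM x₀) (z : M × G), e.toPartialEquiv = s.chart hH z := by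
    intro e he
    obtain ⟨e', he', hee'⟩ := mem_iUnion₂.1 he
    obtain rfl := mem_singleton_iff.1 hee'
    exact he'
  have hmf : IsManifold (𝓘(ℝ, EM).prod 𝓘(ℝ, EG)) ∞ (ReconstructedBundle H) := by
    refine isManifold_of_contDiffOn _ _ _ fun e e' he he' => ?_
    obtain ⟨s, z, hs⟩ := hatlas e he
    obtain ⟨s', z', hs'⟩ := hatlas e' he'
    have h := s.contMDiffOn_chartTransition s' hH z z'
    rw [← hs, ← hs'] at h
    rw [← contMDiffOn_iff_contDiffOn]
    exact ((𝓘(ℝ, EM).prod 𝓘(ℝ, EG)).contMDiff (n := ∞)).comp_contMDiffOn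
      (h.comp ((𝓘(ℝ, EM).prod 𝓘(ℝ, EG)).contMDiffOn_symm.mono inter_subset_right) fun w hw => hw.1)
  refine ⟨_, _, hmf, ?_⟩
  intro U hU _ ψ hψ hend
  let s : LocalSection EM x₀ := ⟨U, hU, ψ, hψ, hend⟩
  -- Read in the chart `e z`, the map C_ψ is the product chart at `z`. Smoothness of C_ψ and of its
  -- inverse thus reduces to that of charts.
  let e (z : M × G) : OpenPartialHomeomorph (ReconstructedBundle H) (ModelProd EM EG) :=
    c.openPartialHomeomorph (s.chart hH z) ⟨s, z, rfl⟩
  have he (z : M × G) : e z ∈ IsManifold.maximalAtlas (𝓘(ℝ, EM).prod 𝓘(ℝ, EG)) ∞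
      (ReconstructedBundle H) :=
    IsManifold.subset_maximalAtlas (mem_iUnion₂.2 ⟨s.chart hH z, ⟨s, z, rfl⟩, rfl⟩)
  have hsrc (a : ReconstructedBundle H) (ha : a ∈ proj ⁻¹' U) :
      a ∈ (e ((s.trivEquiv hH).symm a)).source :=
    (s.mem_chart_source_iff hH).2 ⟨ha, mem_chart_source _ _⟩
  refine ⟨{ toPartialEquiv := s.trivEquiv hH
            open_source := hU.prod isOpen_univ
            open_target := ?_
            contMDiffOn_toFun := ?_
            contMDiffOn_invFun := ?_ }, rfl, rfl, fun z hz => rfl⟩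
  · refine isOpen_iff_mem_nhds.2 fun a ha => ?_
    filter_upwards [(e _).open_source.mem_nhds (hsrc a ha)] with b hb
    exact ((s.mem_chart_source_iff hH).1 hb).1
  · intro z hz
    have h1 : ContMDiffOn (𝓘(ℝ, EM).prod 𝓘(ℝ, EG)) (𝓘(ℝ, EM).prod 𝓘(ℝ, EG)) ∞
        (fun w => (e z).symm (chartAt (ModelProd EM EG) z w))
        ((chartAt (ModelProd EM EG) z).source ∩ U ×ˢ univ) := by
      refine (contMDiffOn_symm_of_mem_maximalAtlas (he z)).comp
        ((contMDiffOn_chart (x := z)).mono inter_subset_left) fun w hw => ?_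
      refine (s.mem_chart_target_iff hH).2 ⟨(chartAt (ModelProd EM EG) z).map_source hw.1, ?_⟩
      rw [(chartAt (ModelProd EM EG) z).left_inv hw.1]
      exact hw.2.1
    have hopen : IsOpen ((chartAt (ModelProd EM EG) z).source ∩ U ×ˢ univ) :=
      (chartAt (ModelProd EM EG) z).open_source.inter (hU.prod isOpen_univ)
    have hzmem : z ∈ (chartAt (ModelProd EM EG) z).source ∩ U ×ˢ univ :=
      ⟨mem_chart_source _ z, hz⟩
    refine ((h1.congr fun w hw => ?_).contMDiffAt (hopen.mem_nhds hzmem)).contMDiffWithinAt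
    exact congrArg (s.trivEquiv hH) ((chartAt (ModelProd EM EG) z).left_inv hw.1).symm
  · intro a ha
    have h1 : ContMDiffOn (𝓘(ℝ, EM).prod 𝓘(ℝ, EG)) (𝓘(ℝ, EM).prod 𝓘(ℝ, EG)) ∞
        (fun b => (chartAt (ModelProd EM EG) ((s.trivEquiv hH).symm a)).symm
          (e ((s.trivEquiv hH).symm a) b)) (e ((s.trivEquiv hH).symm a)).source :=
      contMDiffOn_chart_symm.comp (contMDiffOn_of_mem_maximalAtlas (he _)) fun b hb =>
        (chartAt (ModelProd EM EG) ((s.trivEquiv hH).symm a)).map_source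
          ((s.mem_chart_source_iff hH).1 hb).2
    refine ((h1.congr fun b hb => ?_).contMDiffAt
      ((e _).open_source.mem_nhds (hsrc a ha))).contMDiffWithinAt
    exact ((chartAt (ModelProd EM EG) ((s.trivEquiv hH).symm a)).left_inv
      ((s.mem_chart_source_iff hH).1 hb).2).symm

end

end Charts

/-! ### Hadamard's lemma and one-sided derivatives. -/

section Calculus

open Filter Asymptotics

variable {E : Type*} [NormedAddCommGroup E] [NormedSpace ℝ E]

/-- Each differentiation under the integral sign produces a factor u. With the weight u^k carried
along, the derivative is an integral of the same kind, which allows induction on the order of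
smoothness. -/
theorem hasDerivAt_integral_pow_smul {f : ℝ → E} (hf : ContDiff ℝ 1 f) (k : ℕ) (s : ℝ) :
    HasDerivAt (fun s => ∫ u in (0 : ℝ)..1, u ^ k • f (u * s))
      (∫ u in (0 : ℝ)..1, u ^ (k + 1) • deriv f (u * s)) s := by
  have hf' : Continuous (deriv f) := hf.continuous_deriv le_rfl
  obtain ⟨C, hC⟩ := ((isCompact_Icc (a := (0 : ℝ)) (b := 1)).prod
    (isCompact_closedBall s 1)).exists_bound_of_continuousOn
    (f := fun z : ℝ × ℝ => z.1 ^ (k + 1) • deriv f (z.1 * z.2)) (by fun_prop)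
  have hc : ∀ x : ℝ, Continuous fun u : ℝ => u ^ k • f (u * x) := fun x => by
    have := hf.continuous
    fun_prop
  refine (intervalIntegral.hasDerivAt_integral_of_dominated_loc_of_deriv_le
    (F' := fun s u => u ^ (k + 1) • deriv f (u * s))
    (bound := fun _ => C) (Metric.closedBall_mem_nhds s one_pos)
    (Eventually.of_forall fun x => (hc x).aestronglyMeasurable)
    ((hc s).intervalIntegrable _ _) ?_ ?_ (by simp) ?_).2
  · exact Continuous.aestronglyMeasurable (by fun_prop)
  · refine Eventually.of_forall fun u hu x hx => hC (u, x) ⟨?_, hx⟩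
    rw [uIoc_of_le zero_le_one] at hu
    exact ⟨hu.1.le, hu.2⟩
  · refine Eventually.of_forall fun u _ x _ => ?_
    have h1 : HasDerivAt f (deriv f (u * x)) (u * x) :=
      (hf.differentiable one_ne_zero).differentiableAt.hasDerivAt
    have h2 : HasDerivAt (fun x : ℝ => u * x) u x := by
      simpa using (hasDerivAt_id x).const_mul u
    have h3 := (h1.scomp x h2).const_smul (u ^ k)
    rwa [smul_smul, ← pow_succ] at h3

theorem contDiff_integral_pow_smul {f : ℝ → E} (hf : ContDiff ℝ ∞ f) (k : ℕ) :
    ContDiff ℝ ∞ (fun s => ∫ u in (0 : ℝ)..1, u ^ k • f (u * s)) := by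
  rw [contDiff_infty]
  intro n
  induction n generalizing f k with
  | zero =>
    rw [Nat.cast_zero, contDiff_zero]
    exact continuous_iff_continuousAt.2 fun s =>
      (hasDerivAt_integral_pow_smul (hf.of_le (by simp)) k s).continuousAt
  | succ n ih =>
    have h : deriv (fun s => ∫ u in (0 : ℝ)..1, u ^ k • f (u * s)) =
        fun s => ∫ u in (0 : ℝ)..1, u ^ (k + 1) • deriv f (u * s) :=
      funext fun s => (hasDerivAt_integral_pow_smul (hf.of_le (by simp)) k s).deriv
    rw [Nat.cast_succ, contDiff_succ_iff_deriv, h]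
    refine ⟨fun s => (hasDerivAt_integral_pow_smul (hf.of_le (by simp)) k s).differentiableAt,
      by simp, ih (contDiff_infty_iff_deriv.1 hf).2 (k + 1)⟩

/-- Hadamard's lemma for curves. -/
theorem exists_contDiff_eq_add_smul [CompleteSpace E] {f : ℝ → E} (hf : ContDiff ℝ ∞ f) :
    ∃ g : ℝ → E, ContDiff ℝ ∞ g ∧ ∀ s, f s = f 0 + s • g s := by
  refine ⟨_, contDiff_integral_pow_smul (contDiff_infty_iff_deriv.1 hf).2 0, fun s => ?_⟩
  have h : ∀ u ∈ uIcc (0 : ℝ) 1, HasDerivAt (fun u : ℝ => f (u * s)) (s • deriv f (u * s)) u := by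
    intro u _
    have h1 : HasDerivAt f (deriv f (u * s)) (u * s) :=
      (contDiff_infty_iff_deriv.1 hf).1.differentiableAt.hasDerivAt
    have h2 : HasDerivAt (fun u : ℝ => u * s) s u := by
      simpa using (hasDerivAt_id u).mul_const s
    exact h1.scomp u h2
  have hc : Continuous fun u : ℝ => s • deriv f (u * s) := by
    have := (contDiff_infty_iff_deriv.1 hf).2.continuous
    fun_prop
  have := intervalIntegral.integral_eq_sub_of_hasDerivAt h (hc.intervalIntegrable _ _)
  rw [intervalIntegral.integral_smul] at this
  simp only [pow_zero, one_smul]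
  rw [this]
  simp

/-- A curve that is smooth on `[0,1]`, composed with an even function that has its minimum at `0`,
is smooth and has a quadratic expansion with smooth coefficient. -/
theorem exists_contDiff_comp_eq_add_sq_smul [CompleteSpace E] {c : ℝ → E}
    (hc : ContDiffOn ℝ ∞ c (Icc 0 1)) :
    ∃ g : ℝ → E, ContDiff ℝ ∞ g ∧ ∀ s, c (s ^ 2 / (1 + s ^ 2)) = c 0 + s ^ 2 • g s := by
  have hpos : ∀ s : ℝ, 0 < 1 + s ^ 2 := fun s => by positivity
  -- All of ℝ is mapped into [0,1], so one-sided smoothness of `c` gives a smooth function on ℝ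
  -- without any extension of `c`.
  have hC : ContDiff ℝ ∞ fun s : ℝ => c (s ^ 2 / (1 + s ^ 2)) := by
    refine hc.comp_contDiff ?_ fun s => ?_
    · exact (contDiff_id.pow 2).div (contDiff_const.add (contDiff_id.pow 2)) fun s => (hpos s).ne'
    · exact ⟨by positivity, (div_le_one (hpos s)).2 (by linarith)⟩
  obtain ⟨g, hg, hg'⟩ := exists_contDiff_eq_add_smul hC
  simp only [ne_eq, OfNat.ofNat_ne_zero, not_false_eq_true, zero_pow, zero_div] at hg'
  -- The composite is even, so its Hadamard quotient is odd, vanishes at 0 and can be divided by s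
  -- once more.
  have hodd : ∀ s : ℝ, s ≠ 0 → g s + g (-s) = 0 := by
    intro s hs
    have h1 := hg' s
    have h2 := hg' (-s)
    rw [neg_sq, h1, add_right_inj, neg_smul] at h2
    have h3 : s • (g s + g (-s)) = 0 := by
      rw [smul_add, h2, neg_add_cancel]
    exact (smul_eq_zero.1 h3).resolve_left hs
  have h0 : g 0 = 0 := by
    have hcont : Continuous fun s => g s + g (-s) := by
      have := hg.continuous
      fun_prop
    have h1 : Tendsto (fun s => g s + g (-s)) (𝓝[≠] 0) (𝓝 (g 0 + g (-0))) :=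
      (hcont.tendsto 0).mono_left nhdsWithin_le_nhds
    have h2 : Tendsto (fun s => g s + g (-s)) (𝓝[≠] 0) (𝓝 0) :=
      tendsto_const_nhds.congr' (by
        filter_upwards [self_mem_nhdsWithin] with s hs using (hodd s hs).symm)
    have h3 := tendsto_nhds_unique h1 h2
    rw [neg_zero, ← two_smul ℝ] at h3
    exact (smul_eq_zero.1 h3).resolve_left two_ne_zero
  obtain ⟨g₂, hg₂, hg₂'⟩ := exists_contDiff_eq_add_smul hg
  refine ⟨g₂, hg₂, fun s => ?_⟩
  rw [hg' s, hg₂' s, h0, zero_add, smul_smul, sq]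

/-- If `f` is constant along the second axis, then only the first component of a curve through the
origin contributes to the derivative of `f` along this curve, and the second one need not be
differentiable. -/
theorem HasStrictFDerivAt.hasDerivWithinAt_comp_of_const {f : ℝ × ℝ → E} {f' : ℝ × ℝ →L[ℝ] E}
    (hf : HasStrictFDerivAt f f' (0, 0)) (hconst : ∀ᶠ s in 𝓝 (0 : ℝ), f (0, s) = f (0, 0))
    {α β : ℝ → ℝ} {α' : ℝ} {S : Set ℝ} (hα : HasDerivWithinAt α α' S 0) (hα0 : α 0 = 0)
    (hβ : ContinuousWithinAt β S 0) (hβ0 : β 0 = 0) :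
    HasDerivWithinAt (fun t => f (α t, β t)) (α' • f' (1, 0)) S 0 := by
  have hβ' : Tendsto β (𝓝[S] 0) (𝓝 0) := by simpa [ContinuousWithinAt, hβ0] using hβ
  have hα' : Tendsto α (𝓝[S] 0) (𝓝 0) := by
    simpa [ContinuousWithinAt, hα0] using hα.continuousWithinAt
  -- Strict differentiability compares the values at (α t, β t) and (0, β t) with an error o(|α t|)
  -- = o(t). The ordinary derivative would leave an error governed by β t, which is of order √t in
  -- the application.
  have hlim : Tendsto (fun t => ((α t, β t), ((0 : ℝ), β t))) (𝓝[S] 0)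
      (𝓝 (((0 : ℝ), (0 : ℝ)), ((0 : ℝ), (0 : ℝ)))) :=
    (hα'.prodMk_nhds hβ').prodMk_nhds (tendsto_const_nhds.prodMk_nhds hβ')
  have h1 := (hasStrictFDerivAt_iff_isLittleO.1 hf).comp_tendsto hlim
  have hαO : α =O[𝓝[S] 0] fun t : ℝ => t := by
    simpa [hα0] using hα.hasFDerivWithinAt.isBigO_sub
  have h2 : (fun t => f (α t, β t) - f (0, β t) - f' (α t, 0)) =o[𝓝[S] 0] fun t : ℝ => t := by
    have h3 := h1.congr_left (f₂ := fun t => f (α t, β t) - f (0, β t) - f' (α t, 0))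
      fun t => by simp only [Function.comp_apply, Prod.mk_sub_mk, sub_zero, sub_self]
    refine h3.trans_isBigO (IsBigO.trans ?_ hαO)
    refine IsBigO.of_bound 1 (Eventually.of_forall fun t => ?_)
    simp
  have h3 : (fun t => (α t - t * α') • f' (1, 0)) =o[𝓝[S] 0] fun t : ℝ => t := by
    have := hasDerivWithinAt_iff_isLittleO.1 hα
    simp only [hα0, sub_zero, smul_eq_mul] at this
    simpa using this.smul_isBigO (isBigO_refl (fun _ : ℝ => f' (1, 0)) (𝓝[S] 0)) |>.trans_isBigO
      (IsBigO.of_bound ‖f' (1, 0)‖ (Eventually.of_forall fun t => by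
        simp [norm_smul, mul_comm]))
  rw [hasDerivWithinAt_iff_isLittleO]
  refine ((h2.add h3).congr' ?_ (by simp [EventuallyEq.refl]))
  filter_upwards [hβ'.eventually hconst] with t ht
  have h4 : f' (α t, 0) = α t • f' (1, 0) := by
    rw [← map_smul]
    simp
  rw [ht, hα0, hβ0, h4, sub_zero, sub_smul, smul_smul]
  abel

end Calculus

/-! ### Parallel transport along coordinate segments. -/

section Transport

open PwPathSpace ReconstructedBundle

variable {EM : Type*} [NormedAddCommGroup EM] [NormedSpace ℝ EM]
  {M : Type*} [TopologicalSpace M] [ChartedSpace EM M] {x₀ : M}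
  {EG : Type*} [NormedAddCommGroup EG] [NormedSpace ℝ EG]
  {G : Type*} [TopologicalSpace G] [ChartedSpace EG G] [Group G] {H : PwLoopSpace EM x₀ → G}

/-- Parallel transport of a point of the total space along a segment in the preferred chart at `x`,
to the point with coordinates `w`. -/
noncomputable def chartTransport (hH : IsHolonomyMap EG H) (x : M) (a : ReconstructedBundle H)
    (w : EM) : ReconstructedBundle H :=
  Quot.lift (fun b : PwPathSpace EM x₀ × G =>
      mk H (b.1.glue (chartSegment x (chartAt EM x b.1.endpoint) w)) b.2)
    (fun b c hbc => by
      rw [← hbc.choose]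
      exact mk_glue_congr hH (Quot.sound hbc) _) a

variable {hH : IsHolonomyMap EG H}

theorem chartTransport_mk (x : M) (p : PwPathSpace EM x₀) (g : G) (w : EM) :
    chartTransport hH x (mk H p g) w =
      mk H (p.glue (chartSegment x (chartAt EM x p.endpoint) w)) g := rfl

theorem chartTransport_act (x : M) (a : ReconstructedBundle H) (g : G) (w : EM) :
    chartTransport hH x (a.act g) w = (chartTransport hH x a w).act g := by
  induction a using Quot.ind with
  | mk b => rfl

theorem chartTransport_self {x : M} {a : ReconstructedBundle H}
    (ha : a.proj ∈ (chartAt EM x).source) : chartTransport hH x a (chartAt EM x a.proj) = a := by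
  induction a using Quot.ind with
  | mk b =>
    have h : chartSegment x (chartAt EM x b.1.endpoint) (chartAt EM x b.1.endpoint) =
        fun _ => b.1.endpoint := by
      ext t
      rw [chartSegment, sub_self, smul_zero, add_zero]
      exact (chartAt EM x).left_inv ha
    refine Eq.trans ?_ (mk_glue_const hH b.1 b.2)
    rw [← h]
    rfl

theorem proj_chartTransport [IsManifold 𝓘(ℝ, EM) ∞ M] {x : M} {B : Set EM} (h : IsChartBall x B)
    {a : ReconstructedBundle H} (ha : a.proj ∈ chartDomain x B) {w : EM} (hw : w ∈ B) :
    (chartTransport hH x a w).proj = (chartAt EM x).symm w := by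
  induction a using Quot.ind with
  | mk b =>
    obtain ⟨hatt, -⟩ := isSmoothFamily_glue_chartSegment (IN := 𝓘(ℝ, ℝ)) (N := ℝ) (V := univ) h
      (isSmoothFamily_const univ b.1) (fun _ _ => ha) (contMDiffOn_const (c := w)) (fun _ _ => hw)
    exact (endpoint_glue (hatt 0 (mem_univ _))).trans (chartSegment_one _ _ _)

end Transport

/-! ### Smoothness of the projection, the action and the transport. -/

section Bundle

open PwPathSpace ReconstructedBundle

variable {EM : Type*} [NormedAddCommGroup EM] [NormedSpace ℝ EM]
  {M : Type*} [TopologicalSpace M] [ChartedSpace EM M] {x₀ : M}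
  {EG : Type*} [NormedAddCommGroup EG] [NormedSpace ℝ EG]
  {G : Type*} [TopologicalSpace G] [ChartedSpace EG G] [Group G]
  {H : PwLoopSpace EM x₀ → G}
  [TopologicalSpace (ReconstructedBundle H)]
  [ChartedSpace (ModelProd EM EG) (ReconstructedBundle H)]

theorem eq_mk_of_mem_target {s : LocalSection EM x₀} {Φ : PartialDiffeomorph
    (𝓘(ℝ, EM).prod 𝓘(ℝ, EG)) (𝓘(ℝ, EM).prod 𝓘(ℝ, EG)) (M × G) (ReconstructedBundle H) ∞}
    (h1 : Φ.source = s.base ×ˢ univ) (h2 : Φ.target = proj ⁻¹' s.base)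
    (h3 : EqOn Φ.toFun (triv H s.toFun) (s.base ×ˢ univ)) {a : ReconstructedBundle H}
    (ha : a.proj ∈ s.base) :
    (Φ.invFun a).1 = a.proj ∧ a = mk H (s.toFun a.proj) (Φ.invFun a).2 := by
  have hat : a ∈ Φ.target := h2 ▸ ha
  have h4 : Φ.invFun a ∈ s.base ×ˢ univ := h1 ▸ Φ.map_target' hat
  have h5 : triv H s.toFun (Φ.invFun a) = a := (h3 h4).symm.trans (Φ.right_inv' hat)
  have h6 : (Φ.invFun a).1 = a.proj := (s.proj_triv h4.1).symm.trans (congrArg proj h5)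
  refine ⟨h6, ?_⟩
  rw [← h6]
  exact h5.symm

variable [IsManifold 𝓘(ℝ, EM) ∞ M] [PreconnectedSpace M]

theorem ReconstructedBundle.HasReconstructedCharts.exists_localTriv
    (hC : HasReconstructedCharts EG H) {x : M} {B : Set EM} (h : IsChartBall x B) :
    ∃ (s : LocalSection EM x₀) (Φ : PartialDiffeomorph (𝓘(ℝ, EM).prod 𝓘(ℝ, EG))
        (𝓘(ℝ, EM).prod 𝓘(ℝ, EG)) (M × G) (ReconstructedBundle H) ∞),
      s.base = chartDomain x B ∧ Φ.source = s.base ×ˢ univ ∧ Φ.target = proj ⁻¹' s.base ∧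
      EqOn Φ.toFun (triv H s.toFun) (s.base ×ˢ univ) := by
  obtain ⟨s, hs⟩ := exists_localSection x₀ h
  obtain ⟨Φ, h1, h2, h3⟩ := hC s.base s.isOpen (hs ▸ h.contractibleSpace) s.toFun s.smooth
    s.endpoint_eq
  exact ⟨s, Φ, hs, h1, h2, h3⟩

theorem ReconstructedBundle.HasReconstructedCharts.contMDiff_proj
    (hC : HasReconstructedCharts EG H) :
    ContMDiff (𝓘(ℝ, EM).prod 𝓘(ℝ, EG)) 𝓘(ℝ, EM) ∞ (proj : ReconstructedBundle H → M) := by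
  intro a
  obtain ⟨B, h⟩ := exists_isChartBall (EM := EM) a.proj
  obtain ⟨s, Φ, hs, h1, h2, h3⟩ := hC.exists_localTriv h
  have ha : a ∈ Φ.target := by
    rw [h2, mem_preimage, hs]
    exact h.mem_chartDomain
  have h4 := (contMDiff_fst.comp_contMDiffOn Φ.contMDiffOn_invFun).contMDiffAt
    (Φ.open_target.mem_nhds ha)
  refine h4.congr_of_eventuallyEq ?_
  filter_upwards [Φ.open_target.mem_nhds ha] with b hb
  rw [h2] at hb
  exact (eq_mk_of_mem_target h1 h2 h3 hb).1.symm

variable [LieGroup 𝓘(ℝ, EG) ∞ G]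

variable {EN : Type*} [NormedAddCommGroup EN] [NormedSpace ℝ EN] [FiniteDimensional ℝ EN]
  {HN : Type*} [TopologicalSpace HN] {IN : ModelWithCorners ℝ EN HN} [IN.Boundaryless]
  {N : Type*} [TopologicalSpace N] [ChartedSpace HN N] [IsManifold IN ∞ N]

/-- The class `{ρ[u], g(u)}` depends smoothly on `u`. -/
theorem ReconstructedBundle.HasReconstructedCharts.contMDiffOn_mk (hC : HasReconstructedCharts EG H)
    (hH : IsHolonomyMap EG H) {V : Set N} (hV : IsOpen V) {ρ : N → PwPathSpace EM x₀}
    (hρ : IsSmoothFamily IN V ρ) {g : N → G} (hg : ContMDiffOn IN 𝓘(ℝ, EG) ∞ g V) :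
    ContMDiffOn IN (𝓘(ℝ, EM).prod 𝓘(ℝ, EG)) ∞ (fun u => mk H (ρ u) (g u)) V := by
  intro u₀ hu₀
  refine ContMDiffAt.contMDiffWithinAt ?_
  obtain ⟨B, h⟩ := exists_isChartBall (EM := EM) (ρ u₀).endpoint
  obtain ⟨s, Φ, hs, h1, h2, h3⟩ := hC.exists_localTriv h
  let V' := V ∩ (fun u => (ρ u).endpoint) ⁻¹' s.base
  have hV' : IsOpen V' := hρ.endpoint.continuousOn.isOpen_inter_preimage hV s.isOpen
  have hρ' : IsSmoothFamily IN V' ρ := PwSmoothOn.mono hρ inter_subset_left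
  have hu₀' : u₀ ∈ V' := ⟨hu₀, by rw [mem_preimage, hs]; exact h.mem_chartDomain⟩
  have hs' : IsSmoothFamily IN V' fun u => s.toFun (ρ u).endpoint :=
    PwSmoothOn.comp s.smooth hρ'.endpoint fun u hu => hu.2
  have he : ∀ u ∈ V', (ρ u).endpoint = (s.toFun (ρ u).endpoint).endpoint :=
    fun u hu => (s.endpoint_eq _ hu.2).symm
  -- In the trivialization near the end point of ρ[u₀], the group coordinate of the class is the
  -- holonomy of the loop formed by ρ[u] and the chosen path to the same end point, times g(u).
  have h4 : ContMDiffOn IN (𝓘(ℝ, EM).prod 𝓘(ℝ, EG)) ∞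
      (fun u => Φ.toFun ((ρ u).endpoint, H ((ρ u).loop (s.toFun (ρ u).endpoint)) * g u)) V' :=
    Φ.contMDiffOn_toFun.comp (hρ'.endpoint.prodMk
      ((hH.contMDiffOn_loop hV' hρ' hs' he).mul (hg.mono inter_subset_left))) fun u hu => by
        rw [mem_preimage, h1]
        exact ⟨hu.2, mem_univ _⟩
  refine (h4.congr fun u hu => ?_).contMDiffAt (hV'.mem_nhds hu₀')
  have hmem : ((ρ u).endpoint, H ((ρ u).loop (s.toFun (ρ u).endpoint)) * g u) ∈
    s.base ×ˢ (univ : Set G) := ⟨hu.2, mem_univ _⟩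
  exact (mk_eq_mk_mul_loop hH (he u hu) _).trans (h3 hmem).symm

variable [FiniteDimensional ℝ EM] [FiniteDimensional ℝ EG]
  [IsManifold (𝓘(ℝ, EM).prod 𝓘(ℝ, EG)) ∞ (ReconstructedBundle H)]

/-- Over a trivialization, a·g is the class of the chosen path to π(a) with group element
(coordinate of a)·g. This is a smooth family indexed by an open part of the manifold E × G, to which
`contMDiffOn_mk` applies. -/
theorem ReconstructedBundle.HasReconstructedCharts.contMDiff_act (hC : HasReconstructedCharts EG H)
    (hH : IsHolonomyMap EG H) :
    ContMDiff ((𝓘(ℝ, EM).prod 𝓘(ℝ, EG)).prod 𝓘(ℝ, EG)) (𝓘(ℝ, EM).prod 𝓘(ℝ, EG)) ∞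
      (fun z : ReconstructedBundle H × G => z.1.act z.2) := by
  intro z
  obtain ⟨B, h⟩ := exists_isChartBall (EM := EM) z.1.proj
  obtain ⟨s, Φ, hs, h1, h2, h3⟩ := hC.exists_localTriv h
  let V : Set (ReconstructedBundle H × G) := Φ.target ×ˢ univ
  have hV : IsOpen V := Φ.open_target.prod isOpen_univ
  have hzV : z ∈ V := ⟨by rw [h2, mem_preimage, hs]; exact h.mem_chartDomain, mem_univ _⟩
  have hinv : ContMDiffOn ((𝓘(ℝ, EM).prod 𝓘(ℝ, EG)).prod 𝓘(ℝ, EG)) (𝓘(ℝ, EM).prod 𝓘(ℝ, EG)) ∞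
      (fun z : ReconstructedBundle H × G => Φ.invFun z.1) V :=
    Φ.contMDiffOn_invFun.comp contMDiffOn_fst fun z hz => hz.1
  have hproj : ContMDiffOn ((𝓘(ℝ, EM).prod 𝓘(ℝ, EG)).prod 𝓘(ℝ, EG)) 𝓘(ℝ, EM) ∞
      (fun z : ReconstructedBundle H × G => z.1.proj) V :=
    (hC.contMDiff_proj.comp contMDiff_fst).contMDiffOn
  have hfam : IsSmoothFamily ((𝓘(ℝ, EM).prod 𝓘(ℝ, EG)).prod 𝓘(ℝ, EG)) V
      (fun z : ReconstructedBundle H × G => s.toFun z.1.proj) :=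
    PwSmoothOn.comp s.smooth hproj fun w hw => by simpa [V, h2] using hw.1
  have h4 := hC.contMDiffOn_mk hH hV hfam
    ((contMDiff_snd.comp_contMDiffOn hinv).mul contMDiffOn_snd)
  refine (h4.congr fun w hw => ?_).contMDiffAt (hV.mem_nhds hzV)
  have hw1 : w.1.proj ∈ s.base := by simpa [V, h2] using hw.1
  conv_lhs => rw [(eq_mk_of_mem_target h1 h2 h3 hw1).2]
  rfl

/-- A local section represents the point by a path that varies smoothly with its projection.
Prolonged by coordinate segments, these paths form a smooth family over an open part of E × EM. -/
theorem ReconstructedBundle.HasReconstructedCharts.contMDiffOn_chartTransport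
    (hC : HasReconstructedCharts EG H) (hH : IsHolonomyMap EG H) {x : M} {B : Set EM}
    (h : IsChartBall x B) :
    ContMDiffOn ((𝓘(ℝ, EM).prod 𝓘(ℝ, EG)).prod 𝓘(ℝ, EM)) (𝓘(ℝ, EM).prod 𝓘(ℝ, EG)) ∞
      (fun z : ReconstructedBundle H × EM => chartTransport hH x z.1 z.2)
      ((proj ⁻¹' chartDomain x B) ×ˢ B) := by
  obtain ⟨s, Φ, hs, h1, h2, h3⟩ := hC.exists_localTriv h
  have hV : IsOpen ((proj ⁻¹' chartDomain x B : Set (ReconstructedBundle H)) ×ˢ B) :=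
    (h.isOpen_chartDomain.preimage hC.contMDiff_proj.continuous).prod h.isOpen
  have hinv : ContMDiffOn ((𝓘(ℝ, EM).prod 𝓘(ℝ, EG)).prod 𝓘(ℝ, EM)) (𝓘(ℝ, EM).prod 𝓘(ℝ, EG)) ∞
      (fun z : ReconstructedBundle H × EM => Φ.invFun z.1) ((proj ⁻¹' chartDomain x B) ×ˢ B) :=
    Φ.contMDiffOn_invFun.comp contMDiffOn_fst fun z hz => by
      rw [mem_preimage, h2, hs]
      exact hz.1
  have hproj : ContMDiffOn ((𝓘(ℝ, EM).prod 𝓘(ℝ, EG)).prod 𝓘(ℝ, EM)) 𝓘(ℝ, EM) ∞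
      (fun z : ReconstructedBundle H × EM => z.1.proj) ((proj ⁻¹' chartDomain x B) ×ˢ B) :=
    (hC.contMDiff_proj.comp contMDiff_fst).contMDiffOn
  have hfam : IsSmoothFamily ((𝓘(ℝ, EM).prod 𝓘(ℝ, EG)).prod 𝓘(ℝ, EM))
      ((proj ⁻¹' chartDomain x B) ×ˢ B)
      (fun z : ReconstructedBundle H × EM => s.toFun z.1.proj) :=
    PwSmoothOn.comp s.smooth hproj fun z hz => hs ▸ hz.1
  have hend : ∀ z ∈ (proj ⁻¹' chartDomain x B : Set (ReconstructedBundle H)) ×ˢ B,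
      (s.toFun z.1.proj).endpoint = z.1.proj := fun z hz => s.endpoint_eq _ (hs ▸ hz.1)
  obtain ⟨-, hglue⟩ := isSmoothFamily_glue_chartSegment h hfam
    (fun z hz => by rw [hend z hz]; exact hz.1) contMDiffOn_snd
    (fun z hz => hz.2)
  refine (hC.contMDiffOn_mk hH hV hglue (contMDiff_snd.comp_contMDiffOn hinv)).congr fun z hz => ?_
  have hz1 : z.1.proj ∈ s.base := hs ▸ hz.1
  conv_lhs => rw [(eq_mk_of_mem_target h1 h2 h3 hz1).2]
  rfl

end Bundle

/-! ### Velocities of curves and the horizontal lift. -/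

section Curves

variable {EP : Type*} [NormedAddCommGroup EP] [NormedSpace ℝ EP]
  {HP : Type*} [TopologicalSpace HP] {IP : ModelWithCorners ℝ EP HP}
  {P : Type*} [TopologicalSpace P] [ChartedSpace HP P]

/-- The velocity of a curve in a manifold, in terms of the preferred chart. -/
theorem hasMFDerivWithinAt_toSpanSingleton_iff {κ : ℝ → P} {S : Set ℝ} {j : ℝ} {v : EP} :
    HasMFDerivWithinAt 𝓘(ℝ, ℝ) IP κ S j (ContinuousLinearMap.toSpanSingleton ℝ (M₁ := EP) v) ↔
      ContinuousWithinAt κ S j ∧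
        HasDerivWithinAt (fun i => extChartAt IP (κ j) (κ i)) v S j := by
  have h : HasMFDerivWithinAt 𝓘(ℝ, ℝ) IP κ S j
      (ContinuousLinearMap.toSpanSingleton ℝ (M₁ := EP) v) ↔ ContinuousWithinAt κ S j ∧
      HasFDerivWithinAt (fun i => extChartAt IP (κ j) (κ i))
        (ContinuousLinearMap.toSpanSingleton ℝ v) (S ∩ range id) j := Iff.rfl
  rw [h, range_id, inter_univ, ← hasDerivWithinAt_iff_hasFDerivWithinAt]

end Curves

section Horizontal

open PwPathSpace ReconstructedBundle Filter

variable {EM : Type*} [NormedAddCommGroup EM] [NormedSpace ℝ EM] [FiniteDimensional ℝ EM]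
  {M : Type*} [TopologicalSpace M] [ChartedSpace EM M] [IsManifold 𝓘(ℝ, EM) ∞ M]
  [PreconnectedSpace M] {x₀ : M}
  {EG : Type*} [NormedAddCommGroup EG] [NormedSpace ℝ EG] [FiniteDimensional ℝ EG]
  {G : Type*} [TopologicalSpace G] [ChartedSpace EG G] [Group G] [LieGroup 𝓘(ℝ, EG) ∞ G]
  {H : PwLoopSpace EM x₀ → G}
  [TopologicalSpace (ReconstructedBundle H)]
  [ChartedSpace (ModelProd EM EG) (ReconstructedBundle H)]
  [IsManifold (𝓘(ℝ, EM).prod 𝓘(ℝ, EG)) ∞ (ReconstructedBundle H)]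

/-- The velocities at `a` of the parallel transports of `a` along segments, in the preferred chart
at `x`. -/
noncomputable def horizontalLift (hH : IsHolonomyMap EG H) (x : M) (a : ReconstructedBundle H) :
    EM →L[ℝ] EM × EG :=
  mfderiv 𝓘(ℝ, EM) (𝓘(ℝ, EM).prod 𝓘(ℝ, EG)) (chartTransport hH x a) (chartAt EM x a.proj)

variable {hH : IsHolonomyMap EG H}

theorem contMDiffOn_chartTransport_right (hC : HasReconstructedCharts EG H) {x : M} {B : Set EM}
    (h : IsChartBall x B) {a : ReconstructedBundle H} (ha : a.proj ∈ chartDomain x B) :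
    ContMDiffOn 𝓘(ℝ, EM) (𝓘(ℝ, EM).prod 𝓘(ℝ, EG)) ∞ (chartTransport hH x a) B :=
  (hC.contMDiffOn_chartTransport hH h).comp (contMDiffOn_const.prodMk contMDiffOn_id)
    fun _ hw => ⟨ha, hw⟩

theorem hasMFDerivAt_chartTransport (hC : HasReconstructedCharts EG H) {x : M} {B : Set EM}
    (h : IsChartBall x B) {a : ReconstructedBundle H} (ha : a.proj ∈ chartDomain x B) :
    HasMFDerivAt 𝓘(ℝ, EM) (𝓘(ℝ, EM).prod 𝓘(ℝ, EG)) (chartTransport hH x a)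
      (chartAt EM x a.proj) (horizontalLift hH x a : EM →L[ℝ] EM × EG) :=
  (((contMDiffOn_chartTransport_right hC h ha).contMDiffAt
    (h.isOpen.mem_nhds ha.2)).mdifferentiableAt (by simp)).hasMFDerivAt

theorem hasFDerivAt_extChartAt_chartTransport (hC : HasReconstructedCharts EG H) {x : M}
    {B : Set EM} (h : IsChartBall x B) {a : ReconstructedBundle H} (ha : a.proj ∈ chartDomain x B) :
    HasFDerivAt
      (fun w => extChartAt (𝓘(ℝ, EM).prod 𝓘(ℝ, EG)) a (chartTransport hH x a w))
      (horizontalLift hH x a) (chartAt EM x a.proj) := by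
  have h1 : HasFDerivWithinAt (fun w => extChartAt (𝓘(ℝ, EM).prod 𝓘(ℝ, EG))
      (chartTransport hH x a (chartAt EM x a.proj)) (chartTransport hH x a w))
      (horizontalLift hH x a) (range id) (chartAt EM x a.proj) :=
    (hasMFDerivAt_chartTransport hC h ha).2
  rwa [chartTransport_self ha.1, range_id, hasFDerivWithinAt_univ] at h1

/-- The velocity of a curve `i ↦ {K(r,i), h}` is horizontal: this only uses the curve on one side
of `j`. -/
theorem mem_range_horizontalLift (hC : HasReconstructedCharts EG H) {x : M} {B : Set EM}
    (h : IsChartBall x B) {r : PwPathSpace EM x₀} {g : G} {j d : ℝ} (hd : d ≠ 0)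
    (hI : ∀ y ∈ Icc (0 : ℝ) 1, j + d * y ∈ Icc (0 : ℝ) 1)
    (hU : ∀ y ∈ Icc (0 : ℝ) 1, r.eval (j + d * y) ∈ chartDomain x B)
    (hr : ContMDiffOn 𝓘(ℝ, ℝ) 𝓘(ℝ, EM) ∞ (fun y => r.eval (j + d * y)) (Icc 0 1)) {v : EM × EG}
    (hv : HasMFDerivWithinAt 𝓘(ℝ, ℝ) (𝓘(ℝ, EM).prod 𝓘(ℝ, EG)) (fun i => mk H (r.contract i) g)
      (Icc 0 1) j (ContinuousLinearMap.toSpanSingleton ℝ (M₁ := EM × EG) v)) :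
    ∃ w, horizontalLift hH x (mk H (r.contract j) g) w = v := by
  set a := mk H (r.contract j) g with ha_def
  have hj : j ∈ Icc (0 : ℝ) 1 := by simpa using hI 0 ⟨le_rfl, zero_le_one⟩
  have ha : a.proj ∈ chartDomain x B := by
    have := hU 0 ⟨le_rfl, zero_le_one⟩
    rwa [mul_zero, add_zero] at this
  set c : ℝ → EM := fun y => chartAt EM x (r.eval (j + d * y)) with hc_def
  have hc : ContDiffOn ℝ ∞ c (Icc 0 1) :=
    contMDiffOn_iff_contDiffOn.1 ((contMDiffOn_chart_chartDomain (B := B)).comp hr hU)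
  have hc0 : c 0 = chartAt EM x a.proj := by
    simp only [hc_def, mul_zero, add_zero]
    rfl
  obtain ⟨C, hC2, hCeq⟩ := exists_contDiff_comp_eq_add_sq_smul hc
  -- With z = (y,s): y = 0 gives a constant curve, s = 0 a straight segment with direction `C 0`,
  -- and y = s² the values of `c` at (st)²/(1+(st)²).
  let W : (ℝ × ℝ) × ℝ → EM := fun z => c 0 + (z.1.1 * z.2 ^ 2) • C (z.1.2 * z.2)
  have hW : ContDiff ℝ ∞ W := by
    have := hC2.comp (contDiff_snd.comp (contDiff_fst (𝕜 := ℝ) (E := ℝ × ℝ) (F := ℝ)) |>.mul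
      contDiff_snd)
    exact contDiff_const.add (((contDiff_fst.comp contDiff_fst).mul (contDiff_snd.pow 2)).smul this)
  obtain ⟨V, hVW, hVo, hV0⟩ : ∃ V : Set (ℝ × ℝ), (∀ z ∈ V, ∀ t ∈ Icc (0 : ℝ) 1, W (z, t) ∈ B) ∧
      IsOpen V ∧ ((0 : ℝ), (0 : ℝ)) ∈ V := by
    refine eventually_nhds_iff.1 (isCompact_Icc.eventually_forall_of_forall_eventually
      fun t _ => hW.continuous.continuousAt.eventually_mem (h.isOpen.mem_nhds ?_))
    simpa [W, hc0] using ha.2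
  let f : ℝ × ℝ → ℝ → M := fun z t => (chartAt EM x).symm (W (z, t))
  obtain ⟨-, hfam⟩ := (isSmoothFamily_const (IN := 𝓘(ℝ, ℝ × ℝ)) V (r.contract j)).glue (f := f)
    (contMDiffOn_chart_symm.comp
      (hW.contMDiff.comp (contMDiff_fst.prodMk_space contMDiff_snd)).contMDiffOn
        fun z hz => h.subset (hVW _ hz.1 _ hz.2))
    (fun z _ => by
      simp only [f, W, zero_pow two_ne_zero, mul_zero, zero_smul, add_zero, hc0]
      exact (chartAt EM x).left_inv ha.1)
  let T : ℝ × ℝ → ReconstructedBundle H := fun z => mk H ((r.contract j).glue (f z)) g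
  have hT : ContMDiffOn 𝓘(ℝ, ℝ × ℝ) (𝓘(ℝ, EM).prod 𝓘(ℝ, EG)) ∞ T V :=
    hC.contMDiffOn_mk hH hVo hfam contMDiffOn_const
  have hT0 : ∀ s, T (0, s) = a := by
    intro s
    have hf0 : f (0, s) = fun _ => (r.contract j).endpoint := by
      ext t
      simp only [f, W, zero_mul, zero_smul, add_zero, hc0]
      exact (chartAt EM x).left_inv ha.1
    simp only [T, hf0]
    exact mk_glue_const hH _ _
  -- The square in `chartSegment` makes the two curves agree pointwise, so no reparametrization is
  -- needed here.
  have hT1 : ∀ y : ℝ, T (y, 0) = chartTransport hH x a (chartAt EM x a.proj + y • C 0) := by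
    intro y
    rw [ha_def, chartTransport_mk]
    simp only [T]
    congr 2
    ext t
    change (chartAt EM x).symm (c 0 + (y * t ^ 2) • C (0 * t)) = (chartAt EM x).symm
      (chartAt EM x a.proj + t ^ 2 • (chartAt EM x a.proj + y • C 0 - chartAt EM x a.proj))
    rw [hc0, zero_mul, add_sub_cancel_left, smul_smul, mul_comm y]
  have hT2 : ∀ s, T (s ^ 2, s) = mk H (r.contract (j + d * (s ^ 2 / (1 + s ^ 2)))) g := by
    intro s
    have hmem : ∀ s : ℝ, s ^ 2 / (1 + s ^ 2) ∈ Icc (0 : ℝ) 1 := fun s =>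
      ⟨by positivity, (div_le_one (by positivity)).2 (by linarith)⟩
    have hfr : (fun t : ℝ => r.eval (j + d * ((s * t) ^ 2 / (1 + (s * t) ^ 2)))) =
        f (s ^ 2, s) := by
      ext t
      simp only [f, W]
      rw [← mul_pow, ← hCeq (s * t)]
      exact ((chartAt EM x).left_inv (hU _ (hmem _)).1).symm
    have hsm : ContMDiffOn 𝓘(ℝ, ℝ) 𝓘(ℝ, EM) ∞
        (fun t : ℝ => r.eval (j + d * ((s * t) ^ 2 / (1 + (s * t) ^ 2)))) (Icc 0 1) := by
      refine hr.comp (ContMDiff.contMDiffOn (ContDiff.contMDiff ?_)) fun t _ => hmem (s * t)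
      exact ((contDiff_const.mul contDiff_id).pow 2).div
        (contDiff_const.add ((contDiff_const.mul contDiff_id).pow 2)) fun t => by positivity
    have hcont : Continuous fun t : ℝ => j + d * ((s * t) ^ 2 / (1 + (s * t) ^ 2)) := by
      have : ∀ t : ℝ, 1 + (s * t) ^ 2 ≠ 0 := fun t => by positivity
      fun_prop (disch := assumption)
    have := mk_contract_eq_mk_glue hH r (hI _ (hmem s)) hj hcont (by simp) (by simp)
      (fun _ _ => rfl) hsm g
    rw [hfr] at this
    exact this.symm
  let F : ℝ × ℝ → EM × EG := fun z => extChartAt (𝓘(ℝ, EM).prod 𝓘(ℝ, EG)) a (T z)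
  have hF : ContDiffAt ℝ ∞ F (0, 0) := by
    rw [← contMDiffAt_iff_contDiffAt]
    refine ContMDiffAt.comp (I' := 𝓘(ℝ, EM).prod 𝓘(ℝ, EG)) _ ?_ (hT.contMDiffAt (hVo.mem_nhds hV0))
    rw [hT0]
    exact contMDiffAt_extChartAt
  have hF' := hF.hasStrictFDerivAt (by simp)
  -- The map t ↦ t/(1-t) inverts y ↦ y/(1+y) on [0,1), so T at (t/(1-t), √(t/(1-t))) is the given
  -- curve at j + d t.
  have hα : HasDerivWithinAt (fun t : ℝ => t / (1 - t)) 1 (Ico 0 1) 0 := by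
    have := HasDerivAt.fun_div (hasDerivAt_id' (0 : ℝ)) ((hasDerivAt_id' (0 : ℝ)).const_sub 1)
      (by simp)
    simpa using this.hasDerivWithinAt
  have hβ : ContinuousWithinAt (fun t : ℝ => √(t / (1 - t))) (Ico 0 1) 0 :=
    Real.continuous_sqrt.continuousAt.comp_continuousWithinAt hα.continuousWithinAt
  have hd1 := HasStrictFDerivAt.hasDerivWithinAt_comp_of_const hF'
    (Eventually.of_forall fun s => by simp only [F, hT0]) hα (by simp) hβ (by simp)
  have hd2 : HasDerivWithinAt
      (fun t : ℝ => extChartAt (𝓘(ℝ, EM).prod 𝓘(ℝ, EG)) a (mk H (r.contract (j + d * t)) g))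
      (d • v) (Ico 0 1) 0 := by
    have h1 := (hasMFDerivWithinAt_toSpanSingleton_iff.1 hv).2
    have h2 : HasDerivWithinAt (fun t : ℝ => j + d * t) d (Ico 0 1) 0 := by
      simpa using (((hasDerivAt_id (0 : ℝ)).const_mul d).const_add j).hasDerivWithinAt
    refine HasDerivWithinAt.scomp_of_eq (0 : ℝ) h1 h2 (fun t ht => hI t ⟨ht.1, ht.2.le⟩) (by simp)
  have hd3 : HasDerivWithinAt
      (fun t : ℝ => extChartAt (𝓘(ℝ, EM).prod 𝓘(ℝ, EG)) a (mk H (r.contract (j + d * t)) g))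
      ((1 : ℝ) • fderiv ℝ F (0, 0) (1, 0)) (Ico 0 1) 0 := by
    refine hd1.congr_of_mem (fun t ht => ?_) ⟨le_rfl, one_pos⟩
    have h1 : 0 < 1 - t := by linarith [ht.2]
    have h2 : √(t / (1 - t)) ^ 2 = t / (1 - t) := Real.sq_sqrt (div_nonneg ht.1 h1.le)
    have h3 := hT2 (√(t / (1 - t)))
    rw [h2] at h3
    have h4 : t / (1 - t) / (1 + t / (1 - t)) = t := by
      field_simp
      ring
    rw [h4] at h3
    simp only [F, h3]
  -- One side determines the velocity, so nothing about the curve on the other side of `j` is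
  -- needed.
  have huniq : UniqueDiffWithinAt ℝ (Ico (0 : ℝ) 1) 0 :=
    (uniqueDiffOn_Ico 0 1) 0 ⟨le_rfl, one_pos⟩
  have hd4 : d • v = (1 : ℝ) • fderiv ℝ F (0, 0) (1, 0) := huniq.eq_deriv _ hd2 hd3
  have hd5 : HasDerivAt (fun y : ℝ => F (y, 0)) (fderiv ℝ F (0, 0) (1, 0)) 0 := by
    have h1 : HasDerivAt (fun y : ℝ => ((y, 0) : ℝ × ℝ)) (1, 0) 0 :=
      (hasDerivAt_id (0 : ℝ)).prodMk (hasDerivAt_const _ _)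
    exact hF'.hasFDerivAt.comp_hasDerivAt_of_eq (0 : ℝ) h1 rfl
  have hd6 : HasDerivAt (fun y : ℝ => F (y, 0)) (horizontalLift hH x a (C 0)) 0 := by
    simp only [F, hT1]
    have h1 : HasDerivAt (fun y : ℝ => chartAt EM x a.proj + y • C 0) (C 0) 0 := by
      simpa using ((hasDerivAt_id (0 : ℝ)).smul_const (C 0)).const_add (chartAt EM x a.proj)
    exact (hasFDerivAt_extChartAt_chartTransport (hH := hH) hC h ha).comp_hasDerivAt_of_eq (0 : ℝ)
      h1 (by simp)
  refine ⟨d⁻¹ • C 0, ?_⟩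
  rw [map_smul, hd6.unique hd5, ← one_smul ℝ (fderiv ℝ F (0, 0) (1, 0)), ← hd4, smul_smul,
    inv_mul_cancel₀ hd, one_smul]

end Horizontal

/-! ### One-sided smooth pieces of a path. -/

section Sides

open PwPathSpace Filter

variable {EM : Type*} [NormedAddCommGroup EM] [NormedSpace ℝ EM]
  {M : Type*} [TopologicalSpace M] [ChartedSpace EM M] {x₀ : M}

/-- A piecewise smooth path is smooth, and stays in a given neighbourhood of `r(j)`, on one side of
`j`. -/
theorem exists_contMDiffOn_side (r : PwPathSpace EM x₀) {j : ℝ} (hj : j ∈ Icc (0 : ℝ) 1)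
    {U : Set M} (hU : IsOpen U) (hjU : r.eval j ∈ U) :
    ∃ d : ℝ, d ≠ 0 ∧ (∀ y ∈ Icc (0 : ℝ) 1, j + d * y ∈ Icc (0 : ℝ) 1) ∧
      (∀ y ∈ Icc (0 : ℝ) 1, r.eval (j + d * y) ∈ U) ∧
      ContMDiffOn 𝓘(ℝ, ℝ) 𝓘(ℝ, EM) ∞ (fun y => r.eval (j + d * y)) (Icc 0 1) := by
  obtain ⟨B, hB⟩ := r.2.smooth
  -- The piece is taken to the right of `j`, except for `j = 1`.
  obtain ⟨e, he, hside⟩ : ∃ e : ℝ, e ≠ 0 ∧ ∀ᶠ δ in 𝓝[>] (0 : ℝ), j + e * δ ∈ Icc (0 : ℝ) 1 := by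
    rcases hj.2.lt_or_eq with h | rfl
    · refine ⟨1, one_ne_zero, ?_⟩
      filter_upwards [Ioo_mem_nhdsGT (sub_pos.2 h)] with δ hδ
      exact ⟨by linarith [hδ.1, hj.1], by linarith [hδ.2]⟩
    · refine ⟨-1, by norm_num, ?_⟩
      filter_upwards [Ioo_mem_nhdsGT one_pos] with δ hδ
      exact ⟨by linarith [hδ.2], by linarith [hδ.1]⟩
  have hnear : ∀ᶠ δ in 𝓝[>] (0 : ℝ), ∀ y ∈ Icc (0 : ℝ) 1, r.eval (j + e * δ * y) ∈ U := by
    have hc : Continuous fun z : ℝ × ℝ => r.eval (j + e * z.1 * z.2) :=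
      r.continuous_eval.comp (by fun_prop)
    refine nhdsWithin_le_nhds (isCompact_Icc.eventually_forall_of_forall_eventually
      fun y _ => hc.continuousAt.eventually_mem (hU.mem_nhds ?_))
    simpa using hjU
  obtain ⟨δ, ⟨⟨hδI, hδU⟩, hδB⟩, hδ⟩ := (((hside.and hnear).and
    (eventually_forall_notMem_Ioo B j e)).and self_mem_nhdsWithin).exists
  have hd : e * δ ≠ 0 := mul_ne_zero he (ne_of_gt hδ)
  have hmem : ∀ y ∈ Icc (0 : ℝ) 1, j + e * δ * y ∈ uIcc j (j + e * δ) := by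
    intro y hy
    have := (convex_uIcc j (j + e * δ)).add_smul_mem left_mem_uIcc right_mem_uIcc hy
    rwa [smul_eq_mul, mul_comm y] at this
  have hsub : uIcc j (j + e * δ) ⊆ Icc 0 1 := uIcc_subset_Icc hj hδI
  refine ⟨e * δ, hd, fun y hy => hsub (hmem y hy), hδU, ?_⟩
  have hlt : min j (j + e * δ) < max j (j + e * δ) :=
    min_lt_max.2 fun h => hd (by linarith)
  refine (hB _ _ (le_min hj.1 hδI.1) hlt (max_le hj.2 hδI.2) hδB).comp
    (ContDiff.contMDiff ?_).contMDiffOn hmem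
  exact contDiff_const.add (contDiff_const.mul contDiff_id)

end Sides

/-! ### The distribution as the range of the horizontal lift. -/

section Horizontal

open PwPathSpace ReconstructedBundle Filter

variable {EM : Type*} [NormedAddCommGroup EM] [NormedSpace ℝ EM]
  {M : Type*} [TopologicalSpace M] [ChartedSpace EM M] [IsManifold 𝓘(ℝ, EM) ∞ M]
  [PreconnectedSpace M] {x₀ : M}
  {EG : Type*} [NormedAddCommGroup EG] [NormedSpace ℝ EG] [FiniteDimensional ℝ EG]
  {G : Type*} [TopologicalSpace G] [ChartedSpace EG G] [Group G] [LieGroup 𝓘(ℝ, EG) ∞ G]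
  {H : PwLoopSpace EM x₀ → G}
  [TopologicalSpace (ReconstructedBundle H)]
  [ChartedSpace (ModelProd EM EG) (ReconstructedBundle H)]
  [IsManifold (𝓘(ℝ, EM).prod 𝓘(ℝ, EG)) ∞ (ReconstructedBundle H)]

/-- A path that ends with a segment, at a given point and with a given direction. -/
theorem exists_path_ending_with_segment {x : M} {B : Set EM} (h : IsChartBall x B) {y w : EM}
    (hy : y ∈ B) (hw : y + w ∈ B) : ∃ r : PwPathSpace EM x₀, ∀ t ∈ Icc (1 / 2 : ℝ) 1,
      r.eval t = (chartAt EM x).symm (y + (2 * (1 - t)) • w) := by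
  obtain ⟨p, hp⟩ := exists_endpoint_eq (EM := EM) x₀ ((chartAt EM x).symm (y + w))
  have hf : ContMDiffOn 𝓘(ℝ, ℝ) 𝓘(ℝ, EM) ∞
      (fun t : ℝ => (chartAt EM x).symm (y + (1 - t) • w)) (Icc 0 1) := by
    refine contMDiffOn_chart_symm.comp (ContDiff.contMDiff ?_).contMDiffOn fun t ht => h.subset ?_
    · exact contDiff_const.add ((contDiff_const.sub contDiff_id).smul contDiff_const)
    · exact h.convex.add_smul_mem hy hw ⟨by linarith [ht.2], by linarith [ht.1]⟩
  have hatt : p.Attachable fun t : ℝ => (chartAt EM x).symm (y + (1 - t) • w) :=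
    ⟨hf, by simp [hp]⟩
  refine ⟨p.glue _, fun t ht => (eval_glue_right hatt ht).trans ?_⟩
  congr 3
  ring

variable [FiniteDimensional ℝ EM]

/-- Let `r` arrive at π(a) along a segment coming from the direction `w`. Going from a to {K(r,i),
g} means retracing the end of `r`, so the curve is a transport of a along that segment, and its
velocity at j = 1 is a nonzero multiple of the lift of `w`. -/
theorem horizontalLift_mem_Γ (hC : HasReconstructedCharts EG H) (hH : IsHolonomyMap EG H) {x : M}
    {B : Set EM} (h : IsChartBall x B) {a : ReconstructedBundle H} (ha : a.proj ∈ chartDomain x B)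
    (w : EM) : horizontalLift hH x a w ∈ Γ EG a := by
  set y := chartAt EM x a.proj with hy
  obtain ⟨δ, hδB, hδ⟩ : ∃ δ : ℝ, y + δ • w ∈ B ∧ 0 < δ := by
    have hc : Continuous fun δ : ℝ => y + δ • w := by fun_prop
    have h1 : ∀ᶠ δ in 𝓝[>] (0 : ℝ), y + δ • w ∈ B :=
      nhdsWithin_le_nhds (hc.continuousAt.eventually_mem (h.isOpen.mem_nhds (by simpa using ha.2)))
    exact (h1.and self_mem_nhdsWithin).exists
  obtain ⟨r, hr⟩ := exists_path_ending_with_segment (x₀ := x₀) h ha.2 hδB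
  have hr1 : (r.contract 1).endpoint = a.proj := by
    have := hr 1 ⟨by norm_num, le_rfl⟩
    rw [sub_self, mul_zero, zero_smul, add_zero, (chartAt EM x).left_inv ha.1] at this
    exact this
  obtain ⟨g, hg⟩ := exists_eq_mk a (r.contract 1) hr1
  have hmem : ∀ i ∈ Icc (1 / 2 : ℝ) 1, y + (2 * (1 - i)) • δ • w ∈ B := fun i hi =>
    h.convex.add_smul_mem ha.2 hδB ⟨by linarith [hi.2], by linarith [hi.1]⟩
  have hκ : ∀ i ∈ Icc (1 / 2 : ℝ) 1, mk H (r.contract i) g =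
      chartTransport hH x a (y + (2 * (1 - i)) • δ • w) := by
    intro i hi
    -- This parameter runs from 1 back to `i`, with the square that matches `chartSegment`.
    have hρ : Continuous fun t : ℝ => 1 + (i - 1) * t ^ 2 := by fun_prop
    have hcur : ∀ t ∈ Icc (0 : ℝ) 1, chartSegment x y (y + (2 * (1 - i)) • δ • w) t =
        r.eval (1 + (i - 1) * t ^ 2) := by
      intro t ht
      have ht2 : t ^ 2 ≤ 1 := pow_le_one₀ ht.1 ht.2
      rw [hr _ ⟨by nlinarith [hi.1, hi.2, sq_nonneg t], by nlinarith [hi.2, sq_nonneg t]⟩,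
        chartSegment, add_sub_cancel_left, smul_smul (t ^ 2)]
      congr 3
      ring
    rw [mk_contract_eq_mk_glue hH r ⟨by linarith [hi.1], hi.2⟩ ⟨zero_le_one, le_rfl⟩ hρ (by simp)
      (by simp) hcur ?_ g]
    · rw [hg, chartTransport_mk, hr1]
    · have h1 := contMDiffOn_chartSegment (IN := 𝓘(ℝ, ℝ)) (N := ℝ) (V := univ) h
        (contMDiffOn_const (c := y)) (contMDiffOn_const (c := y + (2 * (1 - i)) • δ • w))
        (fun _ _ => ha.2) (fun _ _ => hmem i hi)
      exact h1.comp (contMDiff_const (c := (0 : ℝ)) |>.prodMk contMDiff_id).contMDiffOn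
        fun t ht => ⟨mem_univ _, ht⟩
  have hκ1 : (fun i : ℝ => mk H (r.contract i) g) =ᶠ[𝓝[Icc 0 1] 1]
      fun i => chartTransport hH x a (y + (2 * (1 - i)) • δ • w) := by
    filter_upwards [self_mem_nhdsWithin, mem_nhdsWithin_of_mem_nhds
      (Ioi_mem_nhds (show (1 / 2 : ℝ) < 1 by norm_num))] with i hi hi'
    exact hκ i ⟨le_of_lt hi', hi.2⟩
  have hline : HasDerivWithinAt (fun i : ℝ => y + (2 * (1 - i)) • δ • w) ((-2 : ℝ) • δ • w)
      (Icc 0 1) 1 := by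
    have h1 : HasDerivAt (fun i : ℝ => 2 * (1 - i)) (-2 : ℝ) 1 := by
      simpa using ((hasDerivAt_id (1 : ℝ)).const_sub 1).const_mul 2
    exact ((h1.smul_const (δ • w)).const_add y).hasDerivWithinAt
  -- The segment with direction `δ • w` fills only the second half of the parameter interval, whence
  -- the 2, and is traversed towards π(a), whence the sign.
  have hv : (-2 * δ) • horizontalLift hH x a w ∈ Γ EG a := by
    refine Submodule.subset_span ⟨r.contract 1, g, r, 1, rfl, hg, ⟨zero_le_one, le_rfl⟩, ?_⟩
    refine hasMFDerivWithinAt_toSpanSingleton_iff.2 ?_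
    simp only [hH.invComp_self, one_mul]
    refine ⟨?_, ?_⟩
    · refine ContinuousWithinAt.congr_of_eventuallyEq ?_ hκ1 (hκ 1 ⟨by norm_num, le_rfl⟩)
      have hcont : ContinuousAt (chartTransport hH x a) (y + (2 * (1 - (1 : ℝ))) • δ • w) := by
        simp only [sub_self, mul_zero, zero_smul, add_zero]
        exact (hasMFDerivAt_chartTransport hC h ha).continuousAt
      exact hcont.comp_continuousWithinAt (f := fun i : ℝ => y + (2 * (1 - i)) • δ • w)
        hline.continuousWithinAt
    · rw [← hg]
      have h2 :=
        (hasFDerivAt_extChartAt_chartTransport (hH := hH) hC h ha).comp_hasDerivWithinAt_of_eq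
          (1 : ℝ) hline (by simp [hy])
      rw [map_smul, map_smul, smul_smul] at h2
      refine h2.congr_of_eventuallyEq ?_ ?_
      · filter_upwards [hκ1] with i hi
        simp only [hi, Function.comp_apply]
      · simp only [hκ 1 ⟨by norm_num, le_rfl⟩, Function.comp_apply]
  have hw : (-2 * δ)⁻¹ • ((-2 * δ) • horizontalLift hH x a w) = horizontalLift hH x a w :=
    inv_smul_smul₀ (mul_ne_zero (by norm_num) hδ.ne') _
  exact (congrArg (· ∈ Γ EG a) hw).mp (Submodule.smul_mem (Γ EG a) (-2 * δ)⁻¹ hv)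

/-- The distribution `Γ` is made up of the velocities of parallel transports along segments. -/
theorem Γ_eq_range_horizontalLift (hC : HasReconstructedCharts EG H) (hH : IsHolonomyMap EG H)
    {x : M} {B : Set EM} (h : IsChartBall x B) {a : ReconstructedBundle H}
    (ha : a.proj ∈ chartDomain x B) :
    Γ EG a = LinearMap.range (horizontalLift hH x a).toLinearMap := by
  refine le_antisymm (Submodule.span_le.2 ?_) ?_
  · rintro v ⟨p, g, r, j, hj, hag, hj01, hv⟩
    have ha' : a = mk H (r.contract j) (H (p.invComp (r.contract j) hj) * g) :=
      hag.trans ((mk_eq_mk_iff hH).2 ⟨hj, rfl⟩)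
    have hrj : r.eval j ∈ chartDomain x B := by
      rw [ha'] at ha
      exact ha
    obtain ⟨d, hd, hI, hU, hsm⟩ := exists_contMDiffOn_side r hj01 h.isOpen_chartDomain hrj
    obtain ⟨w, hw⟩ := mem_range_horizontalLift (hH := hH) hC h hd hI hU hsm hv
    rw [← ha'] at hw
    exact ⟨w, hw⟩
  · rintro _ ⟨w, rfl⟩
    exact horizontalLift_mem_Γ hC hH h ha w

/-- In the chart at `x`, the projection of the point transported to `w` is `w`. Hence the derivative
of the chart is a left inverse of the composite. -/
theorem mfderiv_proj_comp_horizontalLift_injective (hC : HasReconstructedCharts EG H)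
    (hH : IsHolonomyMap EG H) {x : M} {B : Set EM} (h : IsChartBall x B)
    {a : ReconstructedBundle H} (ha : a.proj ∈ chartDomain x B) :
    Function.Injective fun w => (mfderiv (𝓘(ℝ, EM).prod 𝓘(ℝ, EG)) 𝓘(ℝ, EM)
      (proj : ReconstructedBundle H → M) a : EM × EG →L[ℝ] EM) (horizontalLift hH x a w) := by
  have h1 := hasMFDerivAt_chartTransport (hH := hH) hC h ha
  -- The chain rule needs the derivative at the point transported to its own coordinates, which
  -- equals `a` only by `chartTransport_self`; hence the free `b`.
  have h2 : ∀ b : ReconstructedBundle H, b = a → HasMFDerivAt (𝓘(ℝ, EM).prod 𝓘(ℝ, EG)) 𝓘(ℝ, EM)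
      (proj : ReconstructedBundle H → M) b
      (mfderiv (𝓘(ℝ, EM).prod 𝓘(ℝ, EG)) 𝓘(ℝ, EM)
      (proj : ReconstructedBundle H → M) a : EM × EG →L[ℝ] EM) := by
    rintro _ rfl
    exact ((hC.contMDiff_proj).mdifferentiable (by simp) _).hasMFDerivAt
  have h3 : ∀ z : M, z = a.proj → HasMFDerivAt 𝓘(ℝ, EM) 𝓘(ℝ, EM) (chartAt EM x) z
      (mfderiv 𝓘(ℝ, EM) 𝓘(ℝ, EM) (chartAt EM x) a.proj : EM →L[ℝ] EM) := by
    rintro _ rfl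
    exact (((contMDiffOn_chart_chartDomain (B := B)).contMDiffAt
      (h.isOpen_chartDomain.mem_nhds ha)).mdifferentiableAt (by simp)).hasMFDerivAt
  have h23 := (h2 _ (chartTransport_self ha.1)).comp _ h1
  have h4 := HasMFDerivAt.comp (f := proj ∘ chartTransport hH x a) (chartAt EM x a.proj)
    (h3 _ (congrArg proj (chartTransport_self ha.1))) h23
  have h5 : HasMFDerivAt 𝓘(ℝ, EM) 𝓘(ℝ, EM) (chartAt EM x ∘ proj ∘ chartTransport hH x a)
      (chartAt EM x a.proj) (ContinuousLinearMap.id ℝ EM) := by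
    refine (hasMFDerivAt_id (chartAt EM x a.proj)).congr_of_eventuallyEq ?_
    filter_upwards [h.isOpen.mem_nhds ha.2] with w hw
    simp only [Function.comp_apply, id]
    rw [proj_chartTransport h ha hw, (chartAt EM x).right_inv (h.subset hw)]
  have h6 := hasMFDerivAt_unique h4 h5
  intro w w' hww
  have h7 : ∀ w : EM, (mfderiv 𝓘(ℝ, EM) 𝓘(ℝ, EM) (chartAt EM x) a.proj : EM →L[ℝ] EM)
      ((mfderiv (𝓘(ℝ, EM).prod 𝓘(ℝ, EG)) 𝓘(ℝ, EM)
      (proj : ReconstructedBundle H → M) a : EM × EG →L[ℝ] EM) (horizontalLift hH x a w)) = w :=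
    fun w => DFunLike.congr_fun h6 w
  have h8 := congrArg (mfderiv 𝓘(ℝ, EM) 𝓘(ℝ, EM) (chartAt EM x) a.proj : EM →L[ℝ] EM) hww
  exact (h7 w).symm.trans (h8.trans (h7 w'))

/-- This is the derivative of `chartTransport_act`; it yields the invariance of Γ. -/
theorem horizontalLift_act (hC : HasReconstructedCharts EG H)
    (hH : IsHolonomyMap EG H) {x : M} {B : Set EM} (h : IsChartBall x B)
    {a : ReconstructedBundle H} (ha : a.proj ∈ chartDomain x B) (g : G) :
    horizontalLift hH x (a.act g) = (mfderiv (𝓘(ℝ, EM).prod 𝓘(ℝ, EG)) (𝓘(ℝ, EM).prod 𝓘(ℝ, EG))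
      (fun b : ReconstructedBundle H => b.act g) a : EM × EG →L[ℝ] EM × EG).comp
        (horizontalLift hH x a) := by
  have h1 := hasMFDerivAt_chartTransport (hH := hH) hC h ha
  have h2 : ∀ b : ReconstructedBundle H, b = a → HasMFDerivAt (𝓘(ℝ, EM).prod 𝓘(ℝ, EG))
      (𝓘(ℝ, EM).prod 𝓘(ℝ, EG)) (fun b : ReconstructedBundle H => b.act g) b
      (mfderiv (𝓘(ℝ, EM).prod 𝓘(ℝ, EG)) (𝓘(ℝ, EM).prod 𝓘(ℝ, EG))
      (fun b : ReconstructedBundle H => b.act g) a : EM × EG →L[ℝ] EM × EG) := by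
    rintro _ rfl
    have h3 : ContMDiff (𝓘(ℝ, EM).prod 𝓘(ℝ, EG)) (𝓘(ℝ, EM).prod 𝓘(ℝ, EG)) ∞
        (fun b : ReconstructedBundle H => b.act g) :=
      (hC.contMDiff_act hH).comp (contMDiff_id.prodMk contMDiff_const)
    exact (h3.mdifferentiable (by simp) _).hasMFDerivAt
  have h4 := (h2 _ (chartTransport_self ha.1)).comp _ h1
  have h5 := hasMFDerivAt_chartTransport (hH := hH) hC h (a := a.act g) (by rwa [proj_act])
  rw [proj_act] at h5
  have h6 : chartTransport hH x (a.act g) =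
      (fun b : ReconstructedBundle H => b.act g) ∘ chartTransport hH x a :=
    funext fun w => chartTransport_act x a g w
  rw [h6] at h5
  have h7 := hasMFDerivAt_unique h5 h4
  exact h7

/-- The lift is a partial derivative of the transport, which is jointly smooth in the point and the
target coordinates, taken at the coordinates of the projection. -/
theorem contMDiffOn_horizontalLift (hC : HasReconstructedCharts EG H)
    (hH : IsHolonomyMap EG H) {x : M} {B : Set EM} (h : IsChartBall x B) (w : EM) :
    ContMDiffOn (𝓘(ℝ, EM).prod 𝓘(ℝ, EG)) (𝓘(ℝ, EM).prod 𝓘(ℝ, EG)).tangent ∞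
      (fun b : ReconstructedBundle H => (⟨b, horizontalLift hH x b w⟩ :
        TangentBundle (𝓘(ℝ, EM).prod 𝓘(ℝ, EG)) (ReconstructedBundle H)))
      (proj ⁻¹' chartDomain x B) := by
  intro a ha
  refine ContMDiffAt.contMDiffWithinAt ?_
  have hV : IsOpen (proj ⁻¹' chartDomain x B : Set (ReconstructedBundle H)) :=
    h.isOpen_chartDomain.preimage hC.contMDiff_proj.continuous
  have hg : ContMDiffAt (𝓘(ℝ, EM).prod 𝓘(ℝ, EG)) 𝓘(ℝ, EM) ∞
      (fun b : ReconstructedBundle H => chartAt EM x b.proj) a :=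
    ((contMDiffOn_chart_chartDomain (B := B)).contMDiffAt
      (h.isOpen_chartDomain.mem_nhds ha)).comp a hC.contMDiff_proj.contMDiffAt
  have hS : ContMDiffAt ((𝓘(ℝ, EM).prod 𝓘(ℝ, EG)).prod 𝓘(ℝ, EM)) (𝓘(ℝ, EM).prod 𝓘(ℝ, EG)) ∞
      (Function.uncurry (chartTransport hH x)) (a, chartAt EM x a.proj) :=
    (hC.contMDiffOn_chartTransport hH h).contMDiffAt ((hV.prod h.isOpen).mem_nhds ⟨ha, ha.2⟩)
  have hD := ContMDiffAt.mfderiv (m := ∞) (chartTransport hH x)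
    (fun b : ReconstructedBundle H => chartAt EM x b.proj) hS hg (by simp)
  have hw : ContMDiff 𝓘(ℝ, EM) 𝓘(ℝ, EM).tangent ∞
      (fun y : EM => (⟨y, w⟩ : TangentBundle 𝓘(ℝ, EM) EM)) :=
    contMDiff_vectorSpace_iff_contDiff.2 contDiff_const
  have hb : ContMDiffAt (𝓘(ℝ, EM).prod 𝓘(ℝ, EG)) (𝓘(ℝ, EM).prod 𝓘(ℝ, EG)) ∞
      (fun b : ReconstructedBundle H => chartTransport hH x b (chartAt EM x b.proj)) a :=
    hS.comp a (contMDiffAt_id.prodMk hg)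
  have hfin := ContMDiffAt.clm_apply_of_inCoordinates hD (hw.contMDiffAt.comp a hg) hb
  refine hfin.congr_of_eventuallyEq ?_
  filter_upwards [hV.mem_nhds ha] with b hb
  exact congrArg (fun c : ReconstructedBundle H => (⟨c, horizontalLift hH x b w⟩ :
    TangentBundle (𝓘(ℝ, EM).prod 𝓘(ℝ, EG)) (ReconstructedBundle H))) (chartTransport_self hb.1).symm

end Horizontal

/-- By finite dimension the composite is also surjective, so some `f v` has the same image under `q`
as a given `z`, and `z - f v` lies in the kernel. -/
theorem isCompl_range_ker_of_comp_injective {V W : Type*} [AddCommGroup V] [Module ℝ V]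
    [FiniteDimensional ℝ V] [AddCommGroup W] [Module ℝ W] {f : V →ₗ[ℝ] W} {q : W →ₗ[ℝ] V}
    (h : Function.Injective (q ∘ₗ f)) : IsCompl (LinearMap.range f) (LinearMap.ker q) := by
  constructor
  · rw [Submodule.disjoint_def]
    rintro _ ⟨v, rfl⟩ hv
    rw [h (a₁ := v) (a₂ := 0) (by simpa using hv), map_zero]
  · rw [codisjoint_iff_le_sup]
    intro z _
    obtain ⟨v, hv⟩ := LinearMap.injective_iff_surjective.1 h (q z)
    refine Submodule.mem_sup.2 ⟨f v, ⟨v, rfl⟩, z - f v, ?_, add_sub_cancel _ _⟩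
    rw [LinearMap.mem_ker, map_sub, ← hv, LinearMap.comp_apply, sub_self]

end HolonomyReconstruction

/-! ### Assembly: complement, invariance, and the frame of lifts of a basis of the model space. -/

theorem proposition4p1
    {EM : Type*} [NormedAddCommGroup EM] [NormedSpace ℝ EM] [FiniteDimensional ℝ EM]
    {M : Type*} [TopologicalSpace M] [ChartedSpace EM M] [IsManifold 𝓘(ℝ, EM) ∞ M]
    [T2Space M] [ConnectedSpace M]
    {EG : Type*} [NormedAddCommGroup EG] [NormedSpace ℝ EG] [FiniteDimensional ℝ EG]
    {G : Type*} [TopologicalSpace G] [ChartedSpace EG G] [Group G] [LieGroup 𝓘(ℝ, EG) ∞ G]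
    (x₀ : M) (H : PwLoopSpace EM x₀ → G) (hH : IsHolonomyMap EG H) :
    (∃ (_ : TopologicalSpace (ReconstructedBundle H))
       (_ : ChartedSpace (ModelProd EM EG) (ReconstructedBundle H))
       (_ : IsManifold (𝓘(ℝ, EM).prod 𝓘(ℝ, EG)) ∞ (ReconstructedBundle H)),
      ReconstructedBundle.HasReconstructedCharts EG H) ∧
    ∀ [TopologicalSpace (ReconstructedBundle H)]
      [ChartedSpace (ModelProd EM EG) (ReconstructedBundle H)]
      [IsManifold (𝓘(ℝ, EM).prod 𝓘(ℝ, EG)) ∞ (ReconstructedBundle H)],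
      ReconstructedBundle.HasReconstructedCharts EG H →
        ContMDiff (𝓘(ℝ, EM).prod 𝓘(ℝ, EG)) 𝓘(ℝ, EM) ∞
          (ReconstructedBundle.proj : ReconstructedBundle H → M) ∧
        ContMDiff ((𝓘(ℝ, EM).prod 𝓘(ℝ, EG)).prod 𝓘(ℝ, EG)) (𝓘(ℝ, EM).prod 𝓘(ℝ, EG)) ∞
          (fun z : ReconstructedBundle H × G => z.1.act z.2) ∧
        IsSmoothConnection (𝓘(ℝ, EM).prod 𝓘(ℝ, EG)) 𝓘(ℝ, EM)
          (ReconstructedBundle.proj : ReconstructedBundle H → M)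
          ReconstructedBundle.act
          (ReconstructedBundle.Γ EG : (a : ReconstructedBundle H) → _) := by
  refine ⟨exists_hasReconstructedCharts hH, fun hC =>
    ⟨hC.contMDiff_proj, hC.contMDiff_act hH, fun a => ?_, fun a g => ?_, fun a => ?_⟩⟩
  · obtain ⟨B, h⟩ := exists_isChartBall (EM := EM) a.proj
    rw [Γ_eq_range_horizontalLift hC hH h h.mem_chartDomain]
    exact isCompl_range_ker_of_comp_injective
      (mfderiv_proj_comp_horizontalLift_injective hC hH h h.mem_chartDomain)
  · obtain ⟨B, h⟩ := exists_isChartBall (EM := EM) a.proj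
    rw [Γ_eq_range_horizontalLift hC hH h h.mem_chartDomain,
      Γ_eq_range_horizontalLift hC hH h (a := a.act g)
        (by rw [ReconstructedBundle.proj_act]; exact h.mem_chartDomain),
      horizontalLift_act hC hH h h.mem_chartDomain]
    exact (LinearMap.range_comp _ _).symm
  · obtain ⟨B, h⟩ := exists_isChartBall (EM := EM) a.proj
    refine ⟨ReconstructedBundle.proj ⁻¹' chartDomain a.proj B,
      h.isOpen_chartDomain.preimage hC.contMDiff_proj.continuous, h.mem_chartDomain,
      Module.finrank ℝ EM, fun μ b => horizontalLift hH a.proj b (Module.finBasis ℝ EM μ),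
      fun μ => contMDiffOn_horizontalLift hC hH h _, fun b hb => ⟨?_, ?_⟩⟩
    · refine (Module.finBasis ℝ EM).linearIndependent.map' (horizontalLift hH a.proj b).toLinearMap
        (LinearMap.ker_eq_bot.2 fun w w' hw => ?_)
      exact mfderiv_proj_comp_horizontalLift_injective hC hH h hb (congrArg _ hw)
    · rw [Γ_eq_range_horizontalLift hC hH h hb, LinearMap.range_eq_map,
        ← (Module.finBasis ℝ EM).span_eq, Submodule.map_span, ← range_comp]
      rfl
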